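/- Let $\tau_1,\tau_2,\tau_3\in\mathbb C\setminus\mathbb R$, let $E_i=\mathbb C/(\mathbb Z+\mathbb Z\tau_i)$ with coordinate $z_i$, and let $$\alpha(z_1,z_2,z_3)=(-z_1+\tfrac12,\,-z_2+\tfrac12,\,z_3),\qquad \beta(z_1,z_2,z_3)=(-z_1,\,z_2,\,-z_3)$$ act on $E_1\times E_2\times E_3$. These commuting involutions generate a group $G\cong\mathbb Z/2\times\mathbb Z/2$. Let $M_0=(E_1\times E_2\times E_3)/G$, let $F\subset M_0$ be the image of the fixed loci of $\alpha$ and $\beta$ (a disjoint union of elliptic curves, along which $M_0$ is locally $(\mathbb C^2/\pm1)\times\mathbb C$), and let $\pi:M\to M_0$ be the blow-up of $M_0$ along $F$. Thus $M$ is a complex threefold, and near $\pi^{-1}(F)$ it is covered by coordinates $(p,q,s)$ in which $\pi$ is $(p,q,s)\mapsto[u=p^{1/2},\,v=p^{1/2}q,\,s]$, where $u,v$ are, in either order, the two coordinates normal to a fixed curve, centred at it, and $s$ is the coordinate along the curve. The form $dz_1\wedge dz_2\wedge dz_3$ induces a unique holomorphic $(3,0)$-form $\Omega_0$ on the complex manifold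 $M_0\setminus F$. The form $\pi^*\Omega_0$ on $M\setminus\pi^{-1}(F)$ extends uniquely across the exceptional divisors to a holomorphic $(3,0)$-form $\Omega$ on $M$, and $\Omega$ vanishes nowhere on $M$. -/

import Mathlib

open scoped Manifold ContDiff Topology

namespace BorceaVoisin

/-- Complex affine three-space, with coordinates `z 0, z 1, z 2`. -/
abbrev C3 : Type := Fin 3 → ℂ

/-- A holomorphic atlas on a space `M`, given by local parametrizations: the `φ i` are continuous,
open and locally injective maps from open subsets of `ℂ³`, their images cover `M`, and whenever
`φ i v = φ j w` there is a holomorphic germ `h` with `h v = w` and `φ j ∘ h = φ i` near `v`. -/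
structure HolParam (M : Type) [TopologicalSpace M] where
  ι : Type
  V : ι → Set C3
  φ : ∀ i, V i → M
  isOpen_V : ∀ i, IsOpen (V i)
  cover : ∀ x : M, ∃ i, ∃ v : V i, φ i v = x
  cont : ∀ i, Continuous (φ i)
  isOpenMap : ∀ i, IsOpenMap (φ i)
  inj : ∀ i (v : V i), ∀ᶠ p in 𝓝 ((v : C3), (v : C3)), ∀ (h₁ : p.1 ∈ V i) (h₂ : p.2 ∈ V i),
    φ i ⟨p.1, h₁⟩ = φ i ⟨p.2, h₂⟩ → p.1 = p.2
  trans : ∀ i j (v : V i) (w : V j), φ i v = φ j w → ∃ h : C3 → C3, AnalyticAt ℂ h v ∧ h v = w ∧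
    ∀ᶠ v' in 𝓝 (v : C3), ∀ hv : v' ∈ V i, ∃ hw : h v' ∈ V j, φ j ⟨h v', hw⟩ = φ i ⟨v', hv⟩

namespace HolParam

variable {M : Type} [TopologicalSpace M] (P : HolParam M)

theorem exists_dom (x : M) : ∃ (i : P.ι) (W : TopologicalSpace.Opens C3) (hW : (W : Set C3) ⊆ P.V i)
    (w : W), P.φ i ⟨w, hW w.2⟩ = x ∧ Function.Injective fun w : W => P.φ i ⟨w, hW w.2⟩ := by
  obtain ⟨i, v, hv⟩ := P.cover x
  have h := P.inj i v
  rw [nhds_prod_eq] at h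
  obtain ⟨U, hU, h⟩ := Filter.mem_prod_self_iff.1 h
  obtain ⟨W, hWU, hWo, hvW⟩ := mem_nhds_iff.1 (Filter.inter_mem hU ((P.isOpen_V i).mem_nhds v.2))
  refine ⟨i, ⟨W, hWo⟩, fun y hy => (hWU hy).2, ⟨v, hvW⟩, hv, fun y y' hyy => Subtype.ext ?_⟩
  exact h (Set.mk_mem_prod (hWU y.2).1 (hWU y'.2).1) _ _ hyy

/-- Index of the parametrization used around `x`. -/
noncomputable def idx (x : M) : P.ι := (P.exists_dom x).choose

/-- An open set on which that parametrization is injective. -/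
noncomputable def dom (x : M) : TopologicalSpace.Opens C3 := (P.exists_dom x).choose_spec.choose

theorem dom_sub (x : M) : (P.dom x : Set C3) ⊆ P.V (P.idx x) :=
  (P.exists_dom x).choose_spec.choose_spec.choose

/-- The injective local parametrization around `x`. -/
noncomputable def par (x : M) (w : P.dom x) : M := P.φ (P.idx x) ⟨w, P.dom_sub x w.2⟩

theorem mem_par (x : M) : ∃ w : P.dom x, P.par x w = x :=
  (P.exists_dom x).choose_spec.choose_spec.choose_spec.imp fun _ h => h.1

theorem par_inj (x : M) : Function.Injective (P.par x) :=
  (P.exists_dom x).choose_spec.choose_spec.choose_spec.choose_spec.2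

theorem par_emb (x : M) : Topology.IsOpenEmbedding (P.par x) := by
  refine .of_continuous_injective_isOpenMap ?_ (P.par_inj x) ?_
  · exact (P.cont _).comp (continuous_inclusion (P.dom_sub x))
  · exact (P.isOpenMap _).comp ((P.dom x).isOpen.isOpenMap_inclusion (P.dom_sub x))

/-- The chart around `x`: the inverse of the injective local parametrization. -/
noncomputable def chart (x : M) : OpenPartialHomeomorph M C3 :=
  haveI : Nonempty (P.dom x) := ⟨(P.mem_par x).choose⟩
  ((P.par_emb x).toOpenPartialHomeomorph _).symm.trans
    ((P.dom x).openPartialHomeomorphSubtypeCoe inferInstance)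

theorem chart_source (x : M) : (P.chart x).source = Set.range (P.par x) := by
  simp [chart]

theorem chart_target (x : M) : (P.chart x).target = P.dom x := by
  simp [chart]

theorem chart_par (x : M) (w : P.dom x) : P.chart x (P.par x w) = w := by
  have : Nonempty (P.dom x) := ⟨w⟩
  have := ((P.par_emb x).toOpenPartialHomeomorph _).left_inv (x := w) (by simp)
  simp only [Topology.IsOpenEmbedding.toOpenPartialHomeomorph_apply] at this
  simp [chart, this]

theorem chart_symm (x : M) (w : P.dom x) : (P.chart x).symm w = P.par x w := by
  rw [← P.chart_par x w]
  exact (P.chart x).left_inv (by rw [chart_source]; exact ⟨w, rfl⟩)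

/-- The charted space structure. -/
@[reducible] noncomputable def chartedSpace : ChartedSpace C3 M where
  atlas := Set.range P.chart
  chartAt := P.chart
  mem_chart_source x := by rw [chart_source]; exact P.mem_par x
  chart_mem_atlas x := ⟨x, rfl⟩

theorem isManifold : @IsManifold ℂ _ C3 _ _ C3 _ 𝓘(ℂ, C3) ω M _ P.chartedSpace := by
  let _ := P.chartedSpace
  refine isManifold_of_contDiffOn _ _ _ ?_
  rintro _ _ ⟨x, rfl⟩ ⟨y, rfl⟩
  simp only [modelWithCornersSelf_coe, modelWithCornersSelf_coe_symm, Function.id_comp,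
    Function.comp_id, Set.preimage_id, Set.range_id, Set.inter_univ]
  intro v hv
  simp only [OpenPartialHomeomorph.trans_source, OpenPartialHomeomorph.symm_source, Set.mem_inter_iff,
    Set.mem_preimage, chart_target, SetLike.mem_coe] at hv
  obtain ⟨hv, hv2⟩ := hv
  rw [P.chart_symm x ⟨v, hv⟩, chart_source] at hv2
  obtain ⟨w, hw⟩ := hv2
  obtain ⟨h, ha, h1, h2⟩ := P.trans _ _ ⟨v, P.dom_sub x hv⟩ ⟨w, P.dom_sub y w.2⟩ hw.symm
  refine (ha.contDiffAt.congr_of_eventuallyEq ?_).contDiffWithinAt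
  have h3 : ∀ᶠ v' in 𝓝 v, h v' ∈ P.dom y :=
    ha.continuousAt.eventually ((P.dom y).isOpen.mem_nhds (by rw [h1]; exact w.2))
  filter_upwards [h2, h3, (P.dom x).isOpen.mem_nhds hv] with v' h4 h5 h6
  obtain ⟨h7, h8⟩ := h4 (P.dom_sub x h6)
  have : P.par x ⟨v', h6⟩ = P.par y ⟨h v', h5⟩ := h8.symm
  simp only [OpenPartialHomeomorph.coe_trans, Function.comp_apply]
  rw [P.chart_symm x ⟨v', h6⟩, this, chart_par]

end HolParam

/-! ### The torus, the group and the quotient -/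

/-- A complex number that is not real. -/
abbrev Period : Type := {t : ℂ // t.im ≠ 0}

/-- The lattice `ℤ + ℤ t`. -/
def lattice (t : Period) : AddSubgroup ℂ := AddSubgroup.closure {1, (t : ℂ)}

/-- The elliptic curve with periods `1` and `t`. -/
abbrev EllipticCurve (t : Period) : Type := ℂ ⧸ lattice t

/-- The product `E₁ × E₂ × E₃`; the index `i : Fin 3` stands for the factor number `i + 1`. -/
abbrev Torus (τ : Fin 3 → Period) : Type := ∀ i, EllipticCurve (τ i)

/-- The universal covering map of the torus. -/
def proj (τ : Fin 3 → Period) (z : C3) : Torus τ := fun i => (z i : EllipticCurve (τ i))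

/-- `α : (z₁, z₂, z₃) ↦ (-z₁ + 1/2, -z₂ + 1/2, z₃)`. -/
noncomputable def α (τ : Fin 3 → Period) (x : Torus τ) : Torus τ :=
  fun i => if i = 2 then x i else -x i + ((1 / 2 : ℂ) : EllipticCurve (τ i))

/-- `β : (z₁, z₂, z₃) ↦ (-z₁, z₂, -z₃)`. -/
noncomputable def β (τ : Fin 3 → Period) (x : Torus τ) : Torus τ :=
  fun i => if i = 1 then x i else -x i

/-- The action of the group `ℤ/2 × ℤ/2` generated by `α` and `β`. -/
noncomputable def act (τ : Fin 3 → Period) (g : Bool × Bool) (x : Torus τ) : Torus τ :=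
  (if g.1 then α τ else id) ((if g.2 then β τ else id) x)

/-- The linear part of `act g`, a diagonal matrix with entries `±1`: its derivative. -/
def lin (g : Bool × Bool) : C3 :=
  fun i => (if g.1 = true ∧ i ≠ 2 then -1 else 1) * (if g.2 = true ∧ i ≠ 1 then -1 else 1)

/-- The translation part of `act g`. -/
noncomputable def shift (g : Bool × Bool) : C3 := fun i => if g.1 = true ∧ i ≠ 2 then 1 / 2 else 0

/-- The two involutions with fixed points: `true` stands for `α`, `false` for `β`. -/
def invol (b : Bool) : Bool × Bool := (b, !b)

/-- The direction of the fixed curves: those of `α` are parallel to `E₃`, those of `β` to `E₂`. -/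
def tang (b : Bool) : Fin 3 := if b then 2 else 1

/-- The fixed locus of `α` (for `b = true`) or of `β` (for `b = false`) in the torus. -/
def Fix (τ : Fin 3 → Period) (b : Bool) : Set (Torus τ) :=
  Function.fixedPoints (if b then α τ else β τ)

theorem mem_Fix {τ : Fin 3 → Period} {b : Bool} {x : Torus τ} :
    x ∈ Fix τ b ↔ act τ (invol b) x = x := by
  cases b <;> rfl

theorem act_proj (τ : Fin 3 → Period) (g : Bool × Bool) (z : C3) :
    act τ g (proj τ z) = proj τ (lin g * z + shift g) := by
  funext i
  obtain ⟨_ | _, _ | _⟩ := g <;> fin_cases i <;> simp [act, α, β, lin, shift, proj]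

theorem act_add_proj (τ : Fin 3 → Period) (g : Bool × Bool) (x : Torus τ) (u : C3) :
    act τ g (x + proj τ u) = act τ g x + proj τ (lin g * u) := by
  funext i
  obtain ⟨_ | _, _ | _⟩ := g <;> fin_cases i <;> simp [act, α, β, lin, proj] <;> abel

theorem proj_add (τ : Fin 3 → Period) (z w : C3) : proj τ (z + w) = proj τ z + proj τ w := rfl

theorem proj_surjective (τ : Fin 3 → Period) : Function.Surjective (proj τ) := fun x => by
  choose z hz using fun i => QuotientAddGroup.mk_surjective (x i)
  exact ⟨z, funext hz⟩

theorem proj_eq_iff {τ : Fin 3 → Period} {z w : C3} :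
    proj τ z = proj τ w ↔ ∀ i, z i - w i ∈ lattice (τ i) := by
  rw [funext_iff]
  refine forall_congr' fun i => ?_
  simp only [proj]
  rw [eq_comm, QuotientAddGroup.eq, neg_add_eq_sub]

theorem mem_lattice {t : Period} {x : ℂ} : x ∈ lattice t ↔ ∃ m n : ℤ, m + n * (t : ℂ) = x := by
  simp [lattice, AddSubgroup.mem_closure_pair]

theorem half_not_mem (t : Period) : (1 / 2 : ℂ) ∉ lattice t := by
  rw [mem_lattice]
  rintro ⟨m, n, h⟩
  have h1 := congrArg Complex.im h
  have h2 := congrArg Complex.re h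
  simp [t.2] at h1
  subst h1
  simp at h2
  have h3 : (2 * m : ℝ) = 1 := by rw [h2]; norm_num
  norm_cast at h3
  omega

theorem lattice_sep (t : Period) {x : ℂ} (hx : x ∈ lattice t) (h : ‖x‖ < min 1 |(t : ℂ).im|) :
    x = 0 := by
  obtain ⟨m, n, rfl⟩ := mem_lattice.1 hx
  rw [lt_min_iff] at h
  have hn : n = 0 := by
    have h1 := (Complex.abs_im_le_norm _).trans_lt h.2
    simp [abs_mul] at h1
    have h2 : |(n : ℝ)| < 1 := by
      by_contra h3
      have := le_mul_of_one_le_left (abs_nonneg (t : ℂ).im) (not_lt.1 h3)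
      linarith
    exact Int.abs_lt_one_iff.1 (by exact_mod_cast h2)
  subst hn
  have h1 := h.1
  simp at h1
  have h2 : m = 0 := Int.abs_lt_one_iff.1 (by
    exact_mod_cast h1)
  simp [h2]

theorem lattice_disc (t : Period) (δ : ℂ) : ∀ᶠ e in 𝓝 (0 : ℂ), e - δ ∈ lattice t → e = 0 := by
  set r := min 1 |(t : ℂ).im|
  have hr : 0 < r := lt_min one_pos (abs_pos.2 t.2)
  have key : ∀ e e' : ℂ, e - δ ∈ lattice t → e' - δ ∈ lattice t → ‖e‖ < r / 2 → ‖e'‖ < r / 2 →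
      e = e' := fun e e' h h' hn hn' => by
    have h1 := (lattice t).sub_mem h h'
    rw [sub_sub_sub_cancel_right] at h1
    refine sub_eq_zero.1 (lattice_sep t h1 ?_)
    have := norm_sub_le e e'
    linarith
  have hev : ∀ s : ℝ, 0 < s → ∀ᶠ e in 𝓝 (0 : ℂ), ‖e‖ < s := fun s hs =>
    (continuous_norm.tendsto' (0 : ℂ) 0 norm_zero).eventually (gt_mem_nhds hs)
  by_cases h : ∃ e₀ : ℂ, e₀ ≠ 0 ∧ e₀ - δ ∈ lattice t
  · obtain ⟨e₀, h0, h1⟩ := h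
    by_cases h2 : ‖e₀‖ < r / 2
    · filter_upwards [hev _ (norm_pos_iff.2 h0), hev _ (half_pos hr)] with e h3 h4 h5
      rw [key e e₀ h5 h1 h4 h2] at h3
      exact absurd h3 (lt_irrefl _)
    · by_contra hcon
      have : ∃ᶠ e in 𝓝 (0 : ℂ), e - δ ∈ lattice t ∧ e ≠ 0 := by
        refine Filter.not_eventually.1 hcon |>.mono fun e he => by tauto
      obtain ⟨e₁, ⟨h3, h4⟩, h5⟩ := (this.and_eventually (hev _ (half_pos hr))).exists
      refine hcon ?_
      filter_upwards [hev _ (norm_pos_iff.2 h4), hev _ (half_pos hr)] with e h6 h7 h8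
      rw [key e e₁ h8 h3 h7 h5] at h6
      exact absurd h6 (lt_irrefl _)
  · push Not at h
    exact .of_forall fun e he => by_contra fun h0 => h e h0 he

/-- Proper discontinuity of the covering group of `ℂ³ → M₀`. -/
theorem proper_disc (τ : Fin 3 → Period) (z₀ : C3) : ∀ᶠ p in 𝓝 (z₀, z₀), ∀ g,
    act τ g (proj τ p.1) = proj τ p.2 →
      act τ g (proj τ z₀) = proj τ z₀ ∧ p.2 - z₀ = lin g * (p.1 - z₀) := by
  rw [Filter.eventually_all]
  intro g
  have h : ∀ i, ∀ᶠ p : C3 × C3 in 𝓝 (z₀, z₀),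
      ((p.2 - z₀ - lin g * (p.1 - z₀)) i - (lin g * z₀ + shift g - z₀) i ∈ lattice (τ i) →
        (p.2 - z₀ - lin g * (p.1 - z₀)) i = 0) := fun i => by
    have hc : Continuous fun p : C3 × C3 => (p.2 - z₀ - lin g * (p.1 - z₀)) i :=
      (continuous_apply i).comp (by fun_prop)
    exact (hc.tendsto' (z₀, z₀) 0 (by simp)).eventually (lattice_disc (τ i) _)
  filter_upwards [Filter.eventually_all.2 h] with p hp h1
  rw [act_proj, eq_comm, proj_eq_iff] at h1
  have h2 : ∀ i, (p.2 - z₀ - lin g * (p.1 - z₀)) i = 0 := fun i => hp i (by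
    convert h1 i using 1
    simp
    ring)
  refine ⟨?_, sub_eq_zero.1 (funext h2)⟩
  rw [act_proj, eq_comm, proj_eq_iff]
  intro i
  have h3 := h1 i
  have h4 := h2 i
  simp at h3 h4 ⊢
  convert h3 using 1
  linear_combination -h4

theorem coe_half_ne (t : Period) : ((1 / 2 : ℂ) : EllipticCurve t) ≠ 0 := by
  rw [Ne, QuotientAddGroup.eq_zero_iff]
  exact half_not_mem t

theorem coe_half_add (t : Period) :
    ((1 / 2 : ℂ) : EllipticCurve t) + ((1 / 2 : ℂ) : EllipticCurve t) = 0 := by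
  rw [← QuotientAddGroup.mk_add, QuotientAddGroup.eq_zero_iff, mem_lattice]
  exact ⟨1, 0, by norm_num⟩

theorem act_act (τ : Fin 3 → Period) (g h : Bool × Bool) (x : Torus τ) :
    act τ g (act τ h x) = act τ (xor g.1 h.1, xor g.2 h.2) x := by
  funext i
  have h2 := coe_half_add (τ i)
  have h3 := neg_eq_of_add_eq_zero_left h2
  have h4 : ∀ y, ((1 / 2 : ℂ) : EllipticCurve (τ i)) + (((1 / 2 : ℂ) : EllipticCurve (τ i)) + y) = y :=
    fun y => by rw [← add_assoc, h2, zero_add]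
  obtain ⟨_ | _, _ | _⟩ := g <;> obtain ⟨_ | _, _ | _⟩ := h <;> fin_cases i <;>
    simp_all [act, α, β, add_comm, add_left_comm]

theorem lin_lin (g h : Bool × Bool) : lin g * lin h = lin (xor g.1 h.1, xor g.2 h.2) := by
  funext i
  obtain ⟨_ | _, _ | _⟩ := g <;> obtain ⟨_ | _, _ | _⟩ := h <;> fin_cases i <;> simp [lin]

theorem act_self (τ : Fin 3 → Period) (g : Bool × Bool) (x : Torus τ) :
    act τ g (act τ g x) = x := by
  rw [act_act]
  simp [act]

theorem lin_self (g : Bool × Bool) : lin g * lin g = 1 := by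
  rw [lin_lin]
  funext i
  simp [lin]

theorem lin_self_apply (g : Bool × Bool) (i : Fin 3) : lin g i * lin g i = 1 :=
  congrFun (lin_self g) i

/-- An element with a fixed point on a fixed curve is trivial or the involution of that curve. -/
theorem eq_of_fixed {τ : Fin 3 → Period} {b : Bool} {g : Bool × Bool} {x : Torus τ}
    (hx : x ∈ Fix τ b) (h : act τ g x = x) : g = (false, false) ∨ g = invol b := by
  rw [mem_Fix] at hx
  have h0 := congrFun h 0
  have h1 := congrFun hx 0
  have h2 := coe_half_ne (τ 0)
  clear h hx
  obtain ⟨_ | _, _ | _⟩ := g <;> cases b <;> simp_all [invol, act, α, β]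

theorem fixed_mem {τ : Fin 3 → Period} {g : Bool × Bool} {x : Torus τ}
    (hg : g ≠ (false, false)) (h : act τ g x = x) : ∃ b, x ∈ Fix τ b := by
  have h0 := congrFun h 0
  have h2 := coe_half_ne (τ 0)
  obtain ⟨_ | _, _ | _⟩ := g
  · exact absurd rfl hg
  · exact ⟨false, h⟩
  · exact ⟨true, h⟩
  · simp_all [act, α, β]

theorem Fix_unique {τ : Fin 3 → Period} {b b' : Bool} {x : Torus τ}
    (h : x ∈ Fix τ b) (h' : x ∈ Fix τ b') : b = b' := by
  rcases eq_of_fixed h (mem_Fix.1 h') with h1 | h1 <;> cases b <;> cases b' <;> simp_all [invol]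

theorem act_mem_Fix {τ : Fin 3 → Period} {b : Bool} (g : Bool × Bool) {x : Torus τ} :
    act τ g x ∈ Fix τ b ↔ x ∈ Fix τ b := by
  have key : ∀ x, x ∈ Fix τ b → act τ g x ∈ Fix τ b := fun x h => by
    rw [mem_Fix] at h ⊢
    conv_rhs => rw [← h]
    simp only [act_act, Bool.xor_comm]
  exact ⟨fun h => act_self τ g x ▸ key _ h, key x⟩

theorem lin_invol {b : Bool} {i : Fin 3} : lin (invol b) i = if i = tang b then 1 else -1 := by
  cases b <;> fin_cases i <;> simp [lin, invol, tang]

/-- The points of the torus outside the fixed curves. -/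
def Free (τ : Fin 3 → Period) : Set (Torus τ) := {x | ∀ b, x ∉ Fix τ b}

theorem act_mem_Free {τ : Fin 3 → Period} (g : Bool × Bool) {x : Torus τ} :
    act τ g x ∈ Free τ ↔ x ∈ Free τ := forall_congr' fun _ => not_congr (act_mem_Fix g)

theorem isOpen_free (τ : Fin 3 → Period) : IsOpen {z : C3 | proj τ z ∈ Free τ} := by
  rw [isOpen_iff_mem_nhds]
  intro z₀ h0
  have h1 := proper_disc τ z₀
  have h2 : Filter.Tendsto (fun z : C3 => (z, z)) (𝓝 z₀) (𝓝 (z₀, z₀)) :=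
    (continuous_id.prodMk continuous_id).tendsto z₀
  filter_upwards [h2.eventually h1] with z hz b hb
  exact h0 b (mem_Fix.2 (hz _ (mem_Fix.1 hb)).1)

/-- Two points of the torus are identified when they lie in one orbit of the group. -/
def orbitSetoid (τ : Fin 3 → Period) : Setoid (Torus τ) where
  r x y := ∃ g, y = act τ g x
  iseqv :=
    { refl := fun x => ⟨(false, false), rfl⟩
      symm := by
        rintro x _ ⟨g, rfl⟩
        exact ⟨g, (act_self τ g x).symm⟩
      trans := by
        rintro x _ _ ⟨g, rfl⟩ ⟨h, rfl⟩
        exact ⟨_, act_act τ h g x⟩ }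

/-- The singular quotient `M₀ = (E₁ × E₂ × E₃) / (ℤ/2 × ℤ/2)`, with the quotient topology. -/
def M0 (τ : Fin 3 → Period) : Type := Quotient (orbitSetoid τ)

instance (τ : Fin 3 → Period) : TopologicalSpace (M0 τ) :=
  inferInstanceAs (TopologicalSpace (Quotient (orbitSetoid τ)))

/-- The quotient map `E₁ × E₂ × E₃ → M₀`. -/
def toM0 (τ : Fin 3 → Period) (x : Torus τ) : M0 τ := Quotient.mk (orbitSetoid τ) x

/-- The singular curves `F ⊆ M₀`: the image of the fixed curves of `α` and `β`. -/
def F (τ : Fin 3 → Period) : Set (M0 τ) := toM0 τ '' (Fix τ true ∪ Fix τ false)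

theorem toM0_eq {τ : Fin 3 → Period} {x y : Torus τ} :
    toM0 τ x = toM0 τ y ↔ ∃ g, y = act τ g x := Quotient.eq (r := orbitSetoid τ)

theorem toM0_mem_F {τ : Fin 3 → Period} {x : Torus τ} : toM0 τ x ∉ F τ ↔ x ∈ Free τ := by
  constructor
  · exact fun h b hb => h ⟨x, by cases b <;> simp [hb], rfl⟩
  · rintro h ⟨y, hy, hxy⟩
    obtain ⟨g, rfl⟩ := toM0_eq.1 hxy
    rw [act_mem_Free] at h
    exact hy.elim (h true) (h false)

/-- The regular part `M₀ \ F`. -/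
abbrev M0reg (τ : Fin 3 → Period) : Type := {m : M0 τ // m ∉ F τ}

theorem continuous_proj (τ : Fin 3 → Period) : Continuous (proj τ) :=
  continuous_pi fun i => continuous_quot_mk.comp (continuous_apply i)

theorem isOpenMap_proj (τ : Fin 3 → Period) : IsOpenMap (proj τ) :=
  IsOpenMap.piMap (fun i => QuotientAddGroup.isOpenMap_coe (N := lattice (τ i)))
    (Filter.Eventually.of_forall fun _ => QuotientAddGroup.mk_surjective)

theorem continuous_act (τ : Fin 3 → Period) (g : Bool × Bool) : Continuous (act τ g) := by
  refine continuous_pi fun i => ?_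
  obtain ⟨_ | _, _ | _⟩ := g <;> fin_cases i <;> simp [act, α, β] <;> fun_prop

theorem continuous_toM0 (τ : Fin 3 → Period) : Continuous (toM0 τ) := continuous_quot_mk

theorem isOpenMap_toM0 (τ : Fin 3 → Period) : IsOpenMap (toM0 τ) := fun U hU => by
  have h : toM0 τ ⁻¹' (toM0 τ '' U) = ⋃ g, act τ g ⁻¹' U := by
    ext x
    simp only [Set.mem_preimage, Set.mem_image, Set.mem_iUnion]
    constructor
    · rintro ⟨y, hy, h⟩
      obtain ⟨g, rfl⟩ := toM0_eq.1 h
      exact ⟨g, by rwa [act_self]⟩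
    · rintro ⟨g, hg⟩
      exact ⟨_, hg, toM0_eq.2 ⟨g, (act_self τ g x).symm⟩⟩
  refine isOpen_coinduced.2 ?_
  change IsOpen (toM0 τ ⁻¹' (toM0 τ '' U))
  rw [h]
  exact isOpen_iUnion fun g => hU.preimage (continuous_act τ g)

/-- The part of `ℂ³` over `M₀ \ F`. -/
def Ureg (τ : Fin 3 → Period) : TopologicalSpace.Opens C3 :=
  ⟨{z | toM0 τ (proj τ z) ∉ F τ}, by simp only [toM0_mem_F]; exact isOpen_free τ⟩

/-- The covering map onto `M₀ \ F`. -/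
def quotReg (τ : Fin 3 → Period) (z : Ureg τ) : M0reg τ := ⟨toM0 τ (proj τ z), z.2⟩

/-- An analytic germ of the covering group, from one point of an orbit to another. -/
theorem deck_germ {τ : Fin 3 → Period} {z w : C3} {g : Bool × Bool}
    (h : proj τ w = act τ g (proj τ z)) (u : C3) :
    proj τ (w + lin g * (u - z)) = act τ g (proj τ u) := by
  have h1 : u = z + (u - z) := by abel
  conv_rhs => rw [h1, proj_add, act_add_proj, ← h]
  rw [proj_add]

/-- The holomorphic atlas of `M₀ \ F` given by local inverses of the quotient map. -/
def paramM0reg (τ : Fin 3 → Period) : HolParam (M0reg τ) where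
  ι := Unit
  V _ := Ureg τ
  φ _ z := quotReg τ z
  isOpen_V _ := (Ureg τ).isOpen
  cover x := by
    obtain ⟨⟨x⟩, hx⟩ := x
    obtain ⟨z, rfl⟩ := proj_surjective τ x
    exact ⟨(), ⟨z, hx⟩, rfl⟩
  cont _ := Continuous.subtype_mk
    ((continuous_toM0 τ).comp ((continuous_proj τ).comp continuous_subtype_val)) _
  isOpenMap _ U hU := by
    have h1 := (isOpenMap_toM0 τ) _ ((isOpenMap_proj τ) _ ((Ureg τ).isOpen.isOpenMap_subtype_val _ hU))
    refine ⟨_, h1, ?_⟩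
    ext ⟨x, hx⟩
    constructor
    · rintro ⟨_, ⟨_, ⟨z, hz, rfl⟩, rfl⟩, h⟩
      exact ⟨z, hz, Subtype.ext h⟩
    · rintro ⟨z, hz, h⟩
      exact ⟨_, ⟨_, ⟨z, hz, rfl⟩, rfl⟩, congrArg Subtype.val h⟩
  inj _ v := by
    filter_upwards [proper_disc τ v] with p hp h₁ h₂ h
    obtain ⟨g, hg⟩ := toM0_eq.1 (congrArg Subtype.val h)
    obtain ⟨h3, h4⟩ := hp g hg.symm
    by_cases hg0 : g = (false, false)
    · subst hg0
      have h5 : lin (false, false) = 1 := by funext i; simp [lin]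
      rw [h5, one_mul] at h4
      exact (sub_left_injective h4).symm
    · obtain ⟨b, hb⟩ := fixed_mem hg0 h3
      exact absurd hb (toM0_mem_F.1 v.2 b)
  trans _ _ v w h := by
    obtain ⟨g, hg⟩ := toM0_eq.1 (congrArg Subtype.val h)
    refine ⟨fun u => w + lin g * (u - v), ?_, by simp, .of_forall fun u hu => ?_⟩
    · exact analyticAt_const.add (analyticAt_const.mul (analyticAt_id.sub analyticAt_const))
    · have h1 : toM0 τ (proj τ u) = toM0 τ (proj τ ((w : C3) + lin g * (u - v))) :=
        toM0_eq.2 ⟨g, deck_germ hg u⟩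
      refine ⟨?_, Subtype.ext h1.symm⟩
      change _ ∉ F τ
      rw [← h1]
      exact hu

noncomputable instance (τ : Fin 3 → Period) : ChartedSpace C3 (M0reg τ) :=
  (paramM0reg τ).chartedSpace

instance (τ : Fin 3 → Period) : IsManifold 𝓘(ℂ, C3) ω (M0reg τ) := (paramM0reg τ).isManifold

/-! ### The blow-up of the singular curves -/

/-- Homogeneous representatives of the points of the blow-up: pairs `(x, v)` of a point `x` of the
torus and a vector `v` that is `0` if `x` is on no fixed curve, and a nonzero vector normal to
the fixed curve through `x` otherwise. -/
def IsPt (τ : Fin 3 → Period) (p : Torus τ × C3) : Prop :=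
  (p.1 ∈ Free τ → p.2 = 0) ∧ ∀ b, p.1 ∈ Fix τ b → p.2 ≠ 0 ∧ p.2 (tang b) = 0

/-- Two representatives give the same point when a group element and its derivative carry one to the
other, up to a nonzero scalar on the normal vector. -/
def Rel (τ : Fin 3 → Period) (p q : Torus τ × C3) : Prop :=
  ∃ g, ∃ c : ℂ, c ≠ 0 ∧ q.1 = act τ g p.1 ∧ q.2 = c • (lin g * p.2)

theorem Rel.refl {τ : Fin 3 → Period} (p : Torus τ × C3) : Rel τ p p :=
  ⟨(false, false), 1, one_ne_zero, rfl, by funext i; simp [lin]⟩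

theorem Rel.symm {τ : Fin 3 → Period} {p q : Torus τ × C3} (h : Rel τ p q) : Rel τ q p := by
  obtain ⟨g, c, hc, h1, h2⟩ := h
  refine ⟨g, c⁻¹, inv_ne_zero hc, by rw [h1, act_self], ?_⟩
  funext i
  have := lin_self_apply g i
  rw [h2]
  simp only [Pi.smul_apply, Pi.mul_apply, smul_eq_mul]
  rw [show c⁻¹ * (lin g i * (c * (lin g i * p.2 i))) = (c⁻¹ * c) * ((lin g i * lin g i) * p.2 i) by
    ring, this, inv_mul_cancel₀ hc]
  simp

theorem Rel.trans {τ : Fin 3 → Period} {p q r : Torus τ × C3} (h : Rel τ p q) (h' : Rel τ q r) :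
    Rel τ p r := by
  obtain ⟨g, c, hc, h1, h2⟩ := h
  obtain ⟨g', c', hc', h1', h2'⟩ := h'
  refine ⟨_, c' * c, mul_ne_zero hc' hc, by rw [h1', h1, act_act], ?_⟩
  rw [h2', h2, ← lin_lin]
  funext i
  simp
  ring

/-- The identification of homogeneous representatives. -/
def ptSetoid (τ : Fin 3 → Period) : Setoid {p : Torus τ × C3 // IsPt τ p} where
  r p q := Rel τ p q
  iseqv := ⟨fun p => Rel.refl p.1, fun h => Rel.symm h, fun h h' => Rel.trans h h'⟩

/-- The blow-up `M` of `M₀` along `F`, as a set: it has one point over each point of `M₀ \ F`, and over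
a point of `F` the projective line of directions normal to the singular curve. (Transversally
to `F`, the space `M₀` is `ℂ²/±1`, with coordinate functions `u², uv, v²`, which also generate the
ideal of `F`; blowing it up adds the conic of points `[u² : uv : v²]`, that is, the
line of points `[u : v]`.) -/
def M (τ : Fin 3 → Period) : Type := Quotient (ptSetoid τ)

/-- The blow-down map `π : M → M₀`. -/
def π (τ : Fin 3 → Period) : M τ → M0 τ :=
  Quotient.lift (fun p : {p : Torus τ × C3 // IsPt τ p} => toM0 τ p.1.1) fun p q h => by
    obtain ⟨g, c, -, h, -⟩ := h
    exact toM0_eq.2 ⟨g, h⟩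

/-- A local parametrization of `M` at an exceptional curve: `a` is a point of `ℂ³` over a fixed curve
of the involution `invol b`, and `i` is one of the two indices of the normal coordinates. -/
structure LineIndex (τ : Fin 3 → Period) where
  b : Bool
  a : C3
  ha : proj τ a ∈ Fix τ b
  i : Fin 3
  hi : i ≠ tang b

namespace LineIndex

variable {τ : Fin 3 → Period} (L : LineIndex τ)

/-- The point of `ℂ³` whose difference to `a` has the coordinate `ρ` at `i`, the coordinate `ρ * w j` at the
other normal index `j`, and the coordinate `w k` at the tangential index `k`. -/
def pt (ρ : ℂ) (w : C3) : C3 :=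
  fun l => L.a l + if l = L.i then ρ else if l = tang L.b then w l else ρ * w l

/-- The normal vector with coordinate `1` at `i` and `w j` at the other normal index `j`. -/
def dir (w : C3) : C3 := fun l => if l = L.i then 1 else if l = tang L.b then 0 else w l

/-- With `p = w i` and `q = w j`, the point with normal coordinates `p ^ (1/2)` and `p ^ (1/2) * q`. (The
choice of the root is immaterial in `M₀`.) -/
noncomputable def lift (w : C3) : C3 := L.pt ((w L.i) ^ ((2 : ℂ)⁻¹)) w

/-- The inverse of `w ↦ pt ρ w`, where `w i = ρ ^ 2`. -/
noncomputable def coord (z : C3) : C3 := fun l =>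
  if l = L.i then (z l - L.a l) ^ 2 else if l = tang L.b then z l - L.a l
  else (z l - L.a l) / (z L.i - L.a L.i)

end LineIndex

/-- The representative of the point with parameter `z` or `w`: off the fixed curves the point itself
(index `none`), and in the blow-up coordinates `p = w i`, `q = w j`, `s = w k` the point with coordinates
`p ^ (1/2)`, `p ^ (1/2) * q`, `s` if `p ≠ 0`, and the exceptional point `[1 : q]` over
`(0, 0, s)` if `p = 0`. -/
noncomputable def raw (τ : Fin 3 → Period) : Option (LineIndex τ) → C3 → Torus τ × C3
  | none, z => (proj τ z, 0)
  | some L, w => (proj τ (L.lift w), if w L.i = 0 then L.dir w else 0)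

/-- The domains of the parametrizations: the points off the fixed curves, and the parameters that
belong to the exceptional divisor or to a point off the fixed curves. -/
def dom (τ : Fin 3 → Period) : Option (LineIndex τ) → Set C3
  | none => {z | proj τ z ∈ Free τ}
  | some L => {w | w L.i = 0 ∨ proj τ (L.lift w) ∈ Free τ}

section

variable {τ : Fin 3 → Period}

theorem LineIndex.pt_sub (L : LineIndex τ) (ρ : ℂ) (w : C3) :
    L.pt (-ρ) w = L.a + lin (invol L.b) * (L.pt ρ w - L.a) := by
  funext l
  have hi := L.hi
  simp only [pt, Pi.add_apply, Pi.mul_apply, Pi.sub_apply, add_sub_cancel_left, lin_invol]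
  by_cases h1 : l = L.i
  · subst h1; simp [hi]
  · by_cases h2 : l = tang L.b
    · subst h2; simp [h1]
    · simp [h1, h2]

theorem LineIndex.proj_pt_neg (L : LineIndex τ) (ρ : ℂ) (w : C3) :
    proj τ (L.pt (-ρ) w) = act τ (invol L.b) (proj τ (L.pt ρ w)) := by
  rw [L.pt_sub]
  exact deck_germ (mem_Fix.1 L.ha).symm _

theorem LineIndex.pt_zero_mem (L : LineIndex τ) (w : C3) : proj τ (L.pt 0 w) ∈ Fix τ L.b := by
  rw [mem_Fix, ← L.proj_pt_neg, neg_zero]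

theorem LineIndex.lift_of_zero (L : LineIndex τ) {w : C3} (h : w L.i = 0) : L.lift w = L.pt 0 w := by
  rw [lift, h, Complex.zero_cpow (by norm_num)]

theorem LineIndex.proj_lift (L : LineIndex τ) {ρ : ℂ} {w : C3} (h : ρ ^ 2 = w L.i) :
    ∃ g, proj τ (L.pt ρ w) = act τ g (proj τ (L.lift w)) := by
  have h1 : ((w L.i) ^ ((2 : ℂ)⁻¹)) ^ 2 = w L.i := Complex.cpow_ofNat_inv_pow _ 2
  rcases sq_eq_sq_iff_eq_or_eq_neg.1 (h.trans h1.symm) with h2 | h2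
  · exact ⟨(false, false), by rw [h2]; rfl⟩
  · exact ⟨invol L.b, by rw [h2, L.proj_pt_neg]; rfl⟩

theorem LineIndex.dir_ne (L : LineIndex τ) (w : C3) : L.dir w ≠ 0 := fun h => by
  simpa [dir] using congrFun h L.i

theorem isPt_raw : ∀ (o : Option (LineIndex τ)) {v : C3}, v ∈ dom τ o → IsPt τ (raw τ o v)
  | none, v, hv => ⟨fun _ => rfl, fun b hb => absurd hb (hv b)⟩
  | some L, w, hw => by
    by_cases h : w L.i = 0
    · have h1 := L.pt_zero_mem w
      simp only [raw, h, if_true, IsPt, L.lift_of_zero h]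
      refine ⟨fun h2 => absurd h1 (h2 _), fun b hb => ⟨L.dir_ne w, ?_⟩⟩
      rw [Fix_unique hb h1]
      simp [LineIndex.dir, L.hi.symm]
    · have h1 := hw.resolve_left h
      simp only [raw, h, if_false, IsPt]
      exact ⟨fun _ => trivial, fun b hb => absurd hb (h1 b)⟩

/-- The local parametrizations of `M`. -/
noncomputable def par (o : Option (LineIndex τ)) (v : dom τ o) : M τ :=
  Quotient.mk (ptSetoid τ) ⟨raw τ o v, isPt_raw o v.2⟩

theorem par_eq {o o' : Option (LineIndex τ)} {v : dom τ o} {v' : dom τ o'} :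
    par o v = par o' v' ↔ Rel τ (raw τ o v) (raw τ o' v') := Quotient.eq (r := ptSetoid τ)

theorem par_surj (x : M τ) : ∃ o, ∃ v : dom τ o, par o v = x := by
  obtain ⟨⟨⟨x, u⟩, hp⟩⟩ := x
  obtain ⟨z, rfl⟩ := proj_surjective τ x
  by_cases hz : proj τ z ∈ Free τ
  · refine ⟨none, ⟨z, hz⟩, Quotient.sound (s := ptSetoid τ) ?_⟩
    have := hp.1 hz
    simp only at this
    subst this
    exact Rel.refl _
  · simp only [Free, Set.mem_ofPred_eq, not_forall, not_not] at hz
    obtain ⟨b, hb⟩ := hz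
    obtain ⟨h1, h2⟩ := hp.2 b hb
    simp only at h1 h2
    obtain ⟨i, hi⟩ : ∃ i, u i ≠ 0 := by
      by_contra! h
      exact h1 (funext h)
    have hib : i ≠ tang b := fun h => hi (h ▸ h2)
    let L : LineIndex τ := ⟨b, z, hb, i, hib⟩
    let w : C3 := fun l => if l = i then 0 else if l = tang b then 0 else u l / u i
    have hw : w L.i = 0 := if_pos rfl
    refine ⟨some L, ⟨w, Or.inl hw⟩, Quotient.sound (s := ptSetoid τ) ⟨(false, false), u i, hi, ?_, ?_⟩⟩
    · simp only [raw, L.lift_of_zero hw]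
      refine congrArg (proj τ) (funext fun l => ?_)
      simp only [LineIndex.pt, w, L]
      split_ifs <;> simp
    · simp only [raw, hw, if_true]
      funext l
      simp only [LineIndex.dir, lin, L, w, Pi.smul_apply, Pi.mul_apply]
      by_cases h3 : l = i
      · subst h3; simp
      · by_cases h4 : l = tang b
        · subst h4; simp [h3, h2]
        · simp [h3, h4]; field_simp

theorem raw_rel_none {L : LineIndex τ} {ρ : ℂ} {w : C3} (h : ρ ^ 2 = w L.i) (h0 : w L.i ≠ 0) :
    Rel τ (raw τ (some L) w) (raw τ none (L.pt ρ w)) := by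
  obtain ⟨g, hg⟩ := L.proj_lift h
  exact ⟨g, 1, one_ne_zero, hg, by simp [raw, h0]⟩

theorem mem_dom_some {L : LineIndex τ} {ρ : ℂ} {w : C3} (h : ρ ^ 2 = w L.i) (h0 : w L.i ≠ 0) :
    w ∈ dom τ (some L) ↔ L.pt ρ w ∈ dom τ none := by
  obtain ⟨g, hg⟩ := L.proj_lift h
  simp only [dom, Set.mem_ofPred_eq, h0, false_or, hg, act_mem_Free]

theorem LineIndex.coord_pt (L : LineIndex τ) {ρ : ℂ} {w : C3} (h : ρ ^ 2 = w L.i) (h0 : ρ ≠ 0) :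
    L.coord (L.pt ρ w) = w := by
  funext l
  simp only [coord, pt]
  by_cases h1 : l = L.i
  · subst h1; simp [h]
  · by_cases h2 : l = tang L.b
    · subst h2; simp [h1]
    · simp [h1, h2, h0]

theorem LineIndex.pt_coord (L : LineIndex τ) {z : C3} (h : z L.i - L.a L.i ≠ 0) :
    L.pt (z L.i - L.a L.i) (L.coord z) = z := by
  funext l
  simp only [coord, pt]
  by_cases h1 : l = L.i
  · subst h1; simp
  · by_cases h2 : l = tang L.b
    · subst h2; simp [h1]
    · simp [h1, h2]; field_simp; simp

/-- There is a holomorphic germ from `v` to `v'` compatible with the parametrizations. -/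
def Match (τ : Fin 3 → Period) (o : Option (LineIndex τ)) (v : C3) (o' : Option (LineIndex τ))
    (v' : C3) : Prop :=
  ∃ h : C3 → C3, AnalyticAt ℂ h v ∧ h v = v' ∧
    ∀ᶠ x in 𝓝 v, x ∈ dom τ o → h x ∈ dom τ o' ∧ Rel τ (raw τ o x) (raw τ o' (h x))

theorem Match.trans {o o' o'' : Option (LineIndex τ)} {v v' v'' : C3} (h : Match τ o v o' v')
    (h' : Match τ o' v' o'' v'') : Match τ o v o'' v'' := by
  obtain ⟨f, hf, rfl, hf'⟩ := h
  obtain ⟨k, hk, rfl, hk'⟩ := h'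
  refine ⟨k ∘ f, hk.comp hf, rfl, ?_⟩
  filter_upwards [hf', hf.continuousAt.eventually hk'] with x h1 h2 h3
  exact ⟨(h2 (h1 h3).1).1, (h1 h3).2.trans (h2 (h1 h3).1).2⟩

theorem match_none {z w : C3} (h : Rel τ (raw τ none z) (raw τ none w)) : Match τ none z none w := by
  obtain ⟨g, c, hc, h1, -⟩ := h
  refine ⟨fun u => w + lin g * (u - z), ?_, by simp, .of_forall fun u hu => ?_⟩
  · exact analyticAt_const.add (analyticAt_const.mul (analyticAt_id.sub analyticAt_const))
  · have h2 := deck_germ h1 u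
    refine ⟨?_, g, 1, one_ne_zero, h2, by simp [raw]⟩
    change proj τ _ ∈ Free τ
    rw [h2, act_mem_Free]
    exact hu

/-- A local holomorphic inverse of `coord`. -/
theorem exists_branch (L : LineIndex τ) {ρ₀ : ℂ} {w₀ : C3} (h : ρ₀ ^ 2 = w₀ L.i) (h0 : w₀ L.i ≠ 0) :
    ∃ ρ : C3 → ℂ, AnalyticAt ℂ ρ w₀ ∧ ρ w₀ = ρ₀ ∧ ∀ w, ρ w ^ 2 = w L.i := by
  refine ⟨fun w => ρ₀ * (w L.i / w₀ L.i) ^ ((2 : ℂ)⁻¹), ?_, ?_, fun w => ?_⟩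
  · have h1 : AnalyticAt ℂ (fun w : C3 => w L.i) w₀ :=
      (ContinuousLinearMap.proj (R := ℂ) (φ := fun _ : Fin 3 => ℂ) L.i).analyticAt w₀
    refine analyticAt_const.mul ((h1.div analyticAt_const h0).cpow analyticAt_const ?_)
    simp [h0]
  · simp [h0]
  · rw [mul_pow, h, Complex.cpow_ofNat_inv_pow]
    field_simp

theorem analyticAt_pt (L : LineIndex τ) {ρ : C3 → ℂ} {w₀ : C3} (h : AnalyticAt ℂ ρ w₀) :
    AnalyticAt ℂ (fun w => L.pt (ρ w) w) w₀ := by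
  have h1 : ∀ l, AnalyticAt ℂ (fun w : C3 => w l) w₀ := fun l =>
    (ContinuousLinearMap.proj (R := ℂ) (φ := fun _ : Fin 3 => ℂ) l).analyticAt w₀
  refine AnalyticAt.pi fun l => ?_
  simp only [LineIndex.pt]
  refine analyticAt_const.add ?_
  split_ifs
  exacts [h, h1 l, h.mul (h1 l)]

theorem match_some_none {L : LineIndex τ} {ρ₀ : ℂ} {w₀ : C3} (h : ρ₀ ^ 2 = w₀ L.i)
    (h0 : w₀ L.i ≠ 0) : Match τ (some L) w₀ none (L.pt ρ₀ w₀) := by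
  obtain ⟨ρ, h1, h2, h3⟩ := exists_branch L h h0
  refine ⟨fun w => L.pt (ρ w) w, analyticAt_pt L h1, by simp only [h2], ?_⟩
  have h4 : ∀ᶠ w in 𝓝 w₀, w L.i ≠ 0 := (continuous_apply L.i).continuousAt.eventually_ne h0
  filter_upwards [h4] with w h5 h6
  exact ⟨(mem_dom_some (h3 w) h5).1 h6, raw_rel_none (h3 w) h5⟩

theorem match_none_some {L : LineIndex τ} {ρ₀ : ℂ} {w₀ : C3} (h : ρ₀ ^ 2 = w₀ L.i)
    (h0 : w₀ L.i ≠ 0) : Match τ none (L.pt ρ₀ w₀) (some L) w₀ := by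
  have hρ : ρ₀ ≠ 0 := fun h1 => h0 (by rw [← h, h1]; simp)
  have hz : L.pt ρ₀ w₀ L.i - L.a L.i ≠ 0 := by simpa [LineIndex.pt] using hρ
  refine ⟨L.coord, ?_, L.coord_pt h hρ, ?_⟩
  · have h1 : ∀ l, AnalyticAt ℂ (fun z : C3 => z l - L.a l) (L.pt ρ₀ w₀) := fun l =>
      ((ContinuousLinearMap.proj (R := ℂ) (φ := fun _ : Fin 3 => ℂ) l).analyticAt _).sub
        analyticAt_const
    refine AnalyticAt.pi fun l => ?_
    simp only [LineIndex.coord]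
    split_ifs
    exacts [(h1 l).pow 2, h1 l, (h1 l).div (h1 _) hz]
  · have h4 : ∀ᶠ z : C3 in 𝓝 (L.pt ρ₀ w₀), z L.i - L.a L.i ≠ 0 :=
      ((continuous_apply L.i).sub continuous_const).continuousAt.eventually_ne hz
    filter_upwards [h4] with z h5 h6
    have h7 : (z L.i - L.a L.i) ^ 2 = L.coord z L.i := by simp [LineIndex.coord]
    have h8 : L.coord z L.i ≠ 0 := h7 ▸ pow_ne_zero 2 h5
    have h9 := raw_rel_none h7 h8
    have h10 := mem_dom_some h7 h8
    rw [L.pt_coord h5] at h9 h10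
    exact ⟨h10.2 h6, h9.symm⟩

/-- A parameter outside the exceptional divisor. -/
def Off (o : Option (LineIndex τ)) (v : C3) : Prop := ∀ L ∈ o, v L.i ≠ 0

theorem exists_off {o : Option (LineIndex τ)} {v : C3} (h : Off o v) :
    ∃ z, Match τ o v none z ∧ Match τ none z o v ∧ Rel τ (raw τ o v) (raw τ none z) := by
  rcases o with _ | L
  · exact ⟨v, match_none (Rel.refl _), match_none (Rel.refl _), Rel.refl _⟩
  · have h0 := h L rfl
    have h1 : ((v L.i) ^ ((2 : ℂ)⁻¹)) ^ 2 = v L.i := Complex.cpow_ofNat_inv_pow _ 2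
    exact ⟨_, match_some_none h1 h0, match_none_some h1 h0, raw_rel_none h1 h0⟩

theorem off_iff {o : Option (LineIndex τ)} {v : C3} : Off o v ↔ (raw τ o v).2 = 0 := by
  rcases o with _ | L
  · simp [Off, raw]
  · by_cases h : v L.i = 0 <;> simp [Off, raw, h, L.dir_ne]

theorem Rel.off {o o' : Option (LineIndex τ)} {v v' : C3} (h : Rel τ (raw τ o v) (raw τ o' v')) :
    Off o v → Off o' v' := by
  obtain ⟨g, c, -, -, h⟩ := h
  rw [off_iff, off_iff, h]
  intro h
  simp [h]

/-- The germ between two parametrizations at an exceptional point. -/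
theorem match_exc {L L' : LineIndex τ} {w w' : C3} {g : Bool × Bool} (hL : L.b = L'.b)
    (h1 : proj τ (L'.pt 0 w') = act τ g (proj τ (L.pt 0 w)))
    {h : C3 → C3} {s : C3 → ℂ} (ha : AnalyticAt ℂ h w) (hv : h w = w')
    (hs : ∀ᶠ x in 𝓝 w, s x ≠ 0 ∧ h x L'.i = s x ^ 2 * x L.i ∧ 
      L'.dir (h x) = (s x)⁻¹ • (lin g * L.dir x) ∧
      h x (tang L'.b) - w' (tang L'.b) = lin g (tang L.b) * (x (tang L.b) - w (tang L.b))) :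
    Match τ (some L) w (some L') w' := by
  refine ⟨h, ha, hv, ?_⟩
  filter_upwards [hs] with x hx hd
  obtain ⟨h2, h3, h4, h5⟩ := hx
  have hpt : ∀ ρ, L'.pt (s x * ρ) (h x) = L'.pt 0 w' + lin g * (L.pt ρ x - L.pt 0 w) := by
    intro ρ
    have e : ∀ (K : LineIndex τ) (r : ℂ) (y : C3) (l : Fin 3), K.pt r y l =
        K.a l + r * K.dir y l + if l = tang K.b then y l else 0 := by
      intro K r y l
      have hK := K.hi
      simp only [LineIndex.pt, LineIndex.dir]
      by_cases e1 : l = K.i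
      · subst e1; simp [hK]
      · by_cases e2 : l = tang K.b
        · subst e2; simp [e1]
        · simp [e1, e2]
    funext l
    simp only [Pi.add_apply, Pi.mul_apply, Pi.sub_apply, e, h4, Pi.smul_apply, smul_eq_mul, hL]
    rw [hL] at h5
    by_cases e2 : l = tang L'.b
    · subst e2
      simp only [if_true]
      field_simp
      linear_combination h5
    · simp only [e2, if_false]
      field_simp
      ring
  have hproj : ∀ ρ, proj τ (L'.pt (s x * ρ) (h x)) = act τ g (proj τ (L.pt ρ x)) := fun ρ => by
    rw [hpt]
    exact deck_germ h1 _
  by_cases h0 : x L.i = 0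
  · have h0' : h x L'.i = 0 := by rw [h3, h0, mul_zero]
    refine ⟨Or.inl h0', g, (s x)⁻¹, inv_ne_zero h2, ?_, ?_⟩
    · have := hproj 0
      rw [mul_zero] at this
      simp only [raw, L.lift_of_zero h0, L'.lift_of_zero h0', this]
    · simp only [raw, h0, h0', if_true, h4]
  · have h0' : h x L'.i ≠ 0 := by rw [h3]; exact mul_ne_zero (pow_ne_zero 2 h2) h0
    have e1 : ((x L.i) ^ ((2 : ℂ)⁻¹)) ^ 2 = x L.i := Complex.cpow_ofNat_inv_pow _ 2
    set ρ := (x L.i) ^ ((2 : ℂ)⁻¹)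
    have e2 : (s x * ρ) ^ 2 = h x L'.i := by rw [mul_pow, e1, h3]
    refine ⟨?_, (raw_rel_none e1 h0).trans (Rel.trans ⟨g, 1, one_ne_zero, hproj ρ, ?_⟩
      (raw_rel_none e2 h0').symm)⟩
    · rw [mem_dom_some e2 h0']
      rw [mem_dom_some e1 h0] at hd
      change proj τ _ ∈ Free τ
      rw [hproj, act_mem_Free]
      exact hd
    · simp [raw]

theorem match_of_rel {o o' : Option (LineIndex τ)} {v v' : C3}
    (h : Rel τ (raw τ o v) (raw τ o' v')) : Match τ o v o' v' := by
  by_cases hv : Off o v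
  · obtain ⟨z, h1, -, h3⟩ := exists_off hv
    obtain ⟨z', -, h2', h3'⟩ := exists_off (h.off hv)
    exact (h1.trans (match_none ((h3.symm.trans h).trans h3'))).trans h2'
  · have hv' : ¬ Off o' v' := fun h' => hv (h.symm.off h')
    simp only [Off, not_forall, not_not] at hv hv'
    obtain ⟨L, hL, h0⟩ := hv
    obtain ⟨L', hL', h0'⟩ := hv'
    cases Option.mem_def.1 hL
    cases Option.mem_def.1 hL'
    obtain ⟨g, c, hc, h1, h2⟩ := h
    simp only [raw, h0, h0', if_true, L.lift_of_zero h0, L'.lift_of_zero h0'] at h1 h2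
    have hb : L.b = L'.b := by
      have e1 := L'.pt_zero_mem v'
      rw [h1, act_mem_Fix] at e1
      exact Fix_unique (L.pt_zero_mem v) e1
    have hlin : ∀ l, lin g l ≠ 0 := fun l h3 => by
      have := lin_self_apply g l
      simp [h3] at this
    have hco : ∀ l, AnalyticAt ℂ (fun w : C3 => w l) v := fun l =>
      (ContinuousLinearMap.proj (R := ℂ) (φ := fun _ : Fin 3 => ℂ) l).analyticAt v
    have hd := fun l => congrFun h2 l
    simp only [LineIndex.dir, Pi.smul_apply, Pi.mul_apply, smul_eq_mul] at hd
    have hLi := L.hi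
    have hLi' := L'.hi
    by_cases hi : L.i = L'.i
    · have hcc : 1 = c * lin g L'.i := by simpa [hi] using hd L'.i
      refine match_exc hb h1 (s := fun _ => lin g L.i)
        (h := fun x l => if l = L'.i then x l else
          if l = tang L'.b then v' l + lin g l * (x l - v l) else lin g L.i * lin g l * x l)
        (AnalyticAt.pi fun l => ?_) (funext fun l => ?_) (.of_forall fun x => ⟨hlin _, ?_, ?_, ?_⟩)
      · split_ifs
        exacts [hco l, analyticAt_const.add (analyticAt_const.mul ((hco l).sub analyticAt_const)),
          analyticAt_const.mul (hco l)]
      · have := hd l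
        by_cases e1 : l = L'.i
        · subst e1; simp [h0', hi ▸ h0]
        · by_cases e2 : l = tang L'.b
          · subst e2; simp [e1]
          · simp only [hi, hb, e1, e2, if_false] at this ⊢
            rw [this]
            linear_combination (lin g l * v l * c) * lin_self_apply g L'.i +
              (lin g l * v l * lin g L'.i) * hcc
      · simp [hi, pow_two, lin_self_apply]
      · funext l
        have e3 : (lin g L'.i)⁻¹ = lin g L'.i := inv_eq_of_mul_eq_one_left (lin_self_apply g L'.i)
        simp only [LineIndex.dir, Pi.smul_apply, Pi.mul_apply, smul_eq_mul, hi, hb, e3]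
        by_cases e1 : l = L'.i
        · subst e1; simp [lin_self_apply]
        · by_cases e2 : l = tang L'.b
          · subst e2; simp [e1]
          · simp [e1, e2]; ring
      · simp [hb, hLi'.symm]
    · have hi' : L'.i ≠ tang L.b := hb ▸ hLi'
      have hib : L.i ≠ tang L'.b := hb ▸ hLi
      have hcc : 1 = c * (lin g L'.i * v L'.i) := by simpa [Ne.symm hi, hi'] using hd L'.i
      have hv0 : v L'.i ≠ 0 := by
        intro h3
        simp [h3] at hcc
      have hne : ∀ᶠ x : C3 in 𝓝 v, x L'.i ≠ 0 :=
        (continuous_apply L'.i).continuousAt.eventually_ne hv0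
      have hthird : ∀ l, l ≠ L'.i → l ≠ tang L'.b → l = L.i := by
        intro l
        revert hi hLi' hib
        generalize L.i = p
        generalize L'.i = q
        generalize tang L'.b = r
        revert l p q r
        decide
      refine match_exc hb h1 (s := fun x => lin g L'.i * x L'.i)
        (h := fun x l => if l = L'.i then x L.i * x L'.i ^ 2 else
          if l = tang L'.b then v' l + lin g l * (x l - v l) else lin g L.i * lin g L'.i / x L'.i)
        (AnalyticAt.pi fun l => ?_) (funext fun l => ?_) ?_
      · split_ifs
        exacts [(hco _).mul ((hco _).pow 2),
          analyticAt_const.add (analyticAt_const.mul ((hco l).sub analyticAt_const)),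
          analyticAt_const.div (hco _) hv0]
      · by_cases e1 : l = L'.i
        · subst e1; simp [h0', h0]
        · by_cases e2 : l = tang L'.b
          · subst e2; simp [e1]
          · have e3 := hthird l e1 e2
            subst e3
            have := hd L.i
            simp only [hi, hib, if_false, if_true] at this ⊢
            rw [this]
            field_simp
            linear_combination (lin g L.i * lin g L'.i) * hcc + (c * lin g L.i * v L'.i) * lin_self_apply g L'.i
      · filter_upwards [hne] with x hx
        refine ⟨mul_ne_zero (hlin _) hx, ?_, ?_, ?_⟩
        · have := lin_self_apply g L'.i
          simp only [if_true]
          linear_combination (-(x L.i * x L'.i ^ 2)) * this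
        · funext l
          have e3 : (lin g L'.i)⁻¹ = lin g L'.i := inv_eq_of_mul_eq_one_left (lin_self_apply g L'.i)
          simp only [LineIndex.dir, Pi.smul_apply, Pi.mul_apply, smul_eq_mul, hb, mul_inv, e3]
          by_cases e1 : l = L'.i
          · subst e1
            simp only [if_true, Ne.symm hi, hLi', if_false]
            field_simp
            linear_combination (-1 : ℂ) * lin_self_apply g L'.i
          · by_cases e2 : l = tang L'.b
            · subst e2
              simp [hib.symm, hLi'.symm]
            · have e4 := hthird l e1 e2
              subst e4
              simp only [e1, e2, if_true, if_false]
              field_simp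
        · simp [hb, hLi'.symm]

theorem tendsto_diag {f : C3 → C3} {w : C3} (h : ContinuousAt f w) :
    Filter.Tendsto (fun p : C3 × C3 => (f p.1, f p.2)) (𝓝 (w, w)) (𝓝 (f w, f w)) := by
  rw [nhds_prod_eq, nhds_prod_eq]
  exact h.tendsto.prodMap h.tendsto

theorem continuousAt_lift (L : LineIndex τ) {w : C3} (h : w L.i = 0) : ContinuousAt L.lift w := by
  have h1 : ContinuousAt (fun x : C3 => (x L.i) ^ ((2 : ℂ)⁻¹)) w := by
    refine ContinuousAt.comp (g := fun x : ℂ => x ^ ((2 : ℂ)⁻¹)) (f := fun x : C3 => x L.i) ?_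
      (continuous_apply L.i).continuousAt
    exact Complex.continuousAt_cpow_const_of_re_pos (by simp [h]) (by norm_num)
  refine continuousAt_pi.2 fun l => ?_
  simp only [LineIndex.lift, LineIndex.pt]
  refine continuousAt_const.add ?_
  have h2 : ContinuousAt (fun x : C3 => x l) w := (continuous_apply l).continuousAt
  split_ifs
  exacts [h1, h2, h1.mul h2]

theorem isOpen_dom (o : Option (LineIndex τ)) : IsOpen (dom τ o) := by
  rcases o with _ | L
  · exact isOpen_free τ
  rw [isOpen_iff_mem_nhds]
  intro w₀ hw₀
  by_cases h0 : w₀ L.i = 0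
  · have h1 := ((continuous_id.prodMk continuous_id).tendsto w₀).eventually
      ((tendsto_diag (continuousAt_lift L h0)).eventually (proper_disc τ _))
    filter_upwards [h1] with w hw
    refine or_iff_not_imp_right.2 fun h2 => ?_
    simp only [Free, Set.mem_ofPred_eq, not_forall, not_not] at h2
    obtain ⟨b, hb⟩ := h2
    obtain ⟨h3, h4⟩ := hw _ (mem_Fix.1 hb)
    have h5 := L.pt_zero_mem w₀
    rw [← L.lift_of_zero h0] at h5
    have h6 := Fix_unique (mem_Fix.2 h3) h5
    subst h6
    have h7 := congrFun h4 L.i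
    rw [L.lift_of_zero h0] at h7
    simp only [Pi.sub_apply, Pi.mul_apply, lin_invol, L.hi, if_false, id,
      LineIndex.lift, LineIndex.pt, if_true] at h7
    have h8 : (w L.i) ^ ((2 : ℂ)⁻¹) = 0 := by linear_combination h7 / 2
    have h9 : ((w L.i) ^ ((2 : ℂ)⁻¹)) ^ 2 = w L.i := Complex.cpow_ofNat_inv_pow _ 2
    rw [← h9, h8]
    simp
  · have h1 : ((w₀ L.i) ^ ((2 : ℂ)⁻¹)) ^ 2 = w₀ L.i := Complex.cpow_ofNat_inv_pow _ 2
    obtain ⟨ρ, h2, h3, h4⟩ := exists_branch L h1 h0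
    have h5 : ∀ᶠ w in 𝓝 w₀, w L.i ≠ 0 := (continuous_apply L.i).continuousAt.eventually_ne h0
    have h6 : L.pt (ρ w₀) w₀ ∈ dom τ none := (mem_dom_some (h4 w₀) h0).1 hw₀
    filter_upwards [h5, (analyticAt_pt L h2).continuousAt.eventually
      ((isOpen_free τ).mem_nhds h6)] with w h7 h8
    exact (mem_dom_some (h4 w) h7).2 h8

theorem inj_none {z₀ : C3} (h : z₀ ∈ dom τ none) : ∀ᶠ p in 𝓝 (z₀, z₀),
    Rel τ (raw τ none p.1) (raw τ none p.2) → p.1 = p.2 := by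
  filter_upwards [proper_disc τ z₀] with p hp h1
  obtain ⟨g, -, -, hg, -⟩ := h1
  obtain ⟨h3, h4⟩ := hp g hg.symm
  by_cases hg0 : g = (false, false)
  · subst hg0
    have h5 : lin (false, false) = 1 := by funext i; simp [lin]
    rw [h5, one_mul] at h4
    exact (sub_left_injective h4).symm
  · obtain ⟨b, hb⟩ := fixed_mem hg0 h3
    exact absurd hb (h b)

theorem inj_raw (o : Option (LineIndex τ)) {w₀ : C3} (h : w₀ ∈ dom τ o) : ∀ᶠ p in 𝓝 (w₀, w₀),
    Rel τ (raw τ o p.1) (raw τ o p.2) → p.1 = p.2 := by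
  rcases o with _ | L
  · exact inj_none h
  have hsq : ∀ w : C3, ((w L.i) ^ ((2 : ℂ)⁻¹)) ^ 2 = w L.i := fun w => Complex.cpow_ofNat_inv_pow _ 2
  by_cases h0 : w₀ L.i = 0
  · have hF := L.pt_zero_mem w₀
    rw [← L.lift_of_zero h0] at hF
    filter_upwards [(tendsto_diag (continuousAt_lift L h0)).eventually (proper_disc τ _)]
    rintro ⟨w, w'⟩ hp ⟨g, c, hc, h1, h2⟩
    obtain ⟨h3, h4⟩ := hp g h1.symm
    have hk : lin g (tang L.b) = 1 := by
      rcases eq_of_fixed hF h3 with rfl | rfl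
      · simp [lin]
      · simp [lin_invol]
    have hij : ∀ l, l ≠ tang L.b → lin g l = lin g L.i := fun l hl => by
      rcases eq_of_fixed hF h3 with rfl | rfl
      · simp [lin]
      · simp [lin_invol, hl, L.hi]
    have hi := congrFun h4 L.i
    have hr : (w' L.i) ^ ((2 : ℂ)⁻¹) = lin g L.i * (w L.i) ^ ((2 : ℂ)⁻¹) := by
      rw [L.lift_of_zero h0] at hi
      simpa [LineIndex.lift, LineIndex.pt] using hi
    have hwi : w' L.i = w L.i := by
      rw [← hsq w, ← hsq w', hr, mul_pow, pow_two, lin_self_apply, one_mul]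
    funext l
    by_cases e1 : l = L.i
    · subst e1; exact hwi.symm
    by_cases e2 : l = tang L.b
    · subst e2
      have := congrFun h4 (tang L.b)
      rw [L.lift_of_zero h0] at this
      simp only [Pi.sub_apply, Pi.mul_apply, LineIndex.lift, LineIndex.pt, e1, if_false, if_true,
        hk] at this
      linear_combination -this
    by_cases h5 : w L.i = 0
    · simp only [raw, hwi, h5, if_true] at h2
      have h6 := congrFun h2 L.i
      have h7 := congrFun h2 l
      simp only [LineIndex.dir, Pi.smul_apply, Pi.mul_apply, smul_eq_mul, if_true, e1, e2, if_false,
        hij l e2] at h6 h7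
      change w l = w' l
      rw [h7]
      linear_combination (w l) * h6
    · have h6 : (w L.i) ^ ((2 : ℂ)⁻¹) ≠ 0 := fun h6 => h5 (by rw [← hsq w, h6]; simp)
      have h7 := congrFun h4 l
      rw [L.lift_of_zero h0] at h7
      simp only [Pi.sub_apply, Pi.mul_apply, LineIndex.lift, LineIndex.pt, e1, e2, if_false,
        hij l e2, hr] at h7
      have h8 : lin g L.i ≠ 0 := fun h8 => by
        have := lin_self_apply g L.i
        simp [h8] at this
      refine mul_left_cancel₀ (mul_ne_zero h8 h6) ?_
      linear_combination -h7
  · obtain ⟨ρ, h2, h3, h4⟩ := exists_branch L (hsq w₀) h0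
    have h5 : ∀ᶠ w in 𝓝 w₀, w L.i ≠ 0 := (continuous_apply L.i).continuousAt.eventually_ne h0
    have h6 : L.pt (ρ w₀) w₀ ∈ dom τ none := (mem_dom_some (h4 w₀) h0).1 h
    have h7 := (tendsto_diag (analyticAt_pt L h2).continuousAt).eventually (inj_none h6)
    rw [nhds_prod_eq] at h7 ⊢
    filter_upwards [h7, h5.prod_inl _, h5.prod_inr _] with p h8 h9 h10 h11
    have hne : ∀ w : C3, w L.i ≠ 0 → ρ w ≠ 0 := fun w h e => h (by rw [← h4 w, e]; simp)
    have h12 := h8 (((raw_rel_none (h4 _) h9).symm.trans h11).trans (raw_rel_none (h4 _) h10))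
    rw [← L.coord_pt (h4 p.1) (hne _ h9), ← L.coord_pt (h4 p.2) (hne _ h10), h12]

end

/-- The topology of `M`: a set is open when its preimages under all parametrizations are open. -/
noncomputable instance (τ : Fin 3 → Period) : TopologicalSpace (M τ) :=
  ⨆ o, TopologicalSpace.coinduced (par (τ := τ) o) inferInstance

theorem isOpen_M_iff {τ : Fin 3 → Period} {s : Set (M τ)} :
    IsOpen s ↔ ∀ o, IsOpen (par (τ := τ) o ⁻¹' s) := by
  simp only [isOpen_iSup_iff, isOpen_coinduced]

/-- The holomorphic atlas of `M`. -/
noncomputable def paramM (τ : Fin 3 → Period) : HolParam (M τ) where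
  ι := Option (LineIndex τ)
  V := dom τ
  φ := par
  isOpen_V := isOpen_dom
  cover := par_surj
  cont o := continuous_def.2 fun s hs => isOpen_M_iff.1 hs o
  isOpenMap o U hU := by
    refine isOpen_M_iff.2 fun o' => isOpen_iff_mem_nhds.2 ?_
    rintro v' ⟨u, hu, h⟩
    obtain ⟨f, h1, h2, h3⟩ := match_of_rel (par_eq.1 h.symm)
    obtain ⟨U', hU', rfl⟩ := hU
    have h4 : ∀ᶠ x in 𝓝 (v' : C3), f x ∈ U' := h1.continuousAt.eventually
      (hU'.mem_nhds (by rw [h2]; exact hu))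
    filter_upwards [continuous_subtype_val.continuousAt.eventually (h3.and h4)] with x hx
    obtain ⟨h5, h6⟩ := hx.1 x.2
    exact ⟨⟨f x, h5⟩, hx.2, par_eq.2 h6.symm⟩
  inj o v := by
    filter_upwards [inj_raw o v.2] with p hp h₁ h₂ h
    exact hp (par_eq.1 h)
  trans o o' v v' h := by
    obtain ⟨f, h1, h2, h3⟩ := match_of_rel (par_eq.1 h)
    refine ⟨f, h1, h2, ?_⟩
    filter_upwards [h3] with x hx hv
    exact ⟨(hx hv).1, par_eq.2 (hx hv).2.symm⟩

noncomputable instance (τ : Fin 3 → Period) : ChartedSpace C3 (M τ) := (paramM τ).chartedSpace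

instance (τ : Fin 3 → Period) : IsManifold 𝓘(ℂ, C3) ω (M τ) := (paramM τ).isManifold

theorem isOpen_off (τ : Fin 3 → Period) : IsOpen {x : M τ | π τ x ∉ F τ} := by
  refine isOpen_M_iff.2 fun o => ?_
  have h : par (τ := τ) o ⁻¹' {x | π τ x ∉ F τ} = Subtype.val ⁻¹' {v : C3 | Off o v} := by
    ext v
    change toM0 τ (raw τ o v).1 ∉ F τ ↔ Off o v
    rw [toM0_mem_F, off_iff]
    have hp := isPt_raw o v.2
    refine ⟨hp.1, fun h b hb => (hp.2 b hb).1 h⟩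
  rw [h]
  refine IsOpen.preimage continuous_subtype_val ?_
  rcases o with _ | L
  · simp [Off]
  · simp only [Off, Option.mem_some_iff, forall_eq']
    exact isOpen_ne_fun (continuous_apply L.i) continuous_const

/-- The complement of the exceptional divisor `π⁻¹(F)`, an open submanifold of `M`. -/
noncomputable def Mreg (τ : Fin 3 → Period) : TopologicalSpace.Opens (M τ) :=
  ⟨{x | π τ x ∉ F τ}, isOpen_off τ⟩

/-- The restriction `M \ π⁻¹(F) → M₀ \ F` of `π`. -/
def πreg (τ : Fin 3 → Period) (x : Mreg τ) : M0reg τ := ⟨π τ x, x.2⟩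

/-! ### Holomorphic 3-forms -/

/-- A (3,0)-form on a three-dimensional complex manifold: an alternating `ℂ`-trilinear form on each tangent
space. -/
abbrev Form (X : Type) [TopologicalSpace X] [ChartedSpace C3 X] : Type :=
  ∀ x : X, TangentSpace 𝓘(ℂ, C3) x [⋀^Fin 3]→L[ℂ] ℂ

/-- The pullback `f^* η`. -/
noncomputable def pullback {X Y : Type} [TopologicalSpace X] [ChartedSpace C3 X]
    [TopologicalSpace Y] [ChartedSpace C3 Y] (f : X → Y) (η : Form Y) : Form X :=
  fun x => (η (f x)).compContinuousLinearMap (mfderiv 𝓘(ℂ, C3) 𝓘(ℂ, C3) f x)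

/-- A 3-form is holomorphic when its expressions in charts, which are functions from open subsets of
`ℂ³` to the space of alternating trilinear forms on `ℂ³`, are holomorphic. -/
def IsHolomorphic {X : Type} [TopologicalSpace X] [ChartedSpace C3 X] (η : Form X) : Prop :=
  ∀ x : X, DifferentiableOn ℂ (F := C3 [⋀^Fin 3]→L[ℂ] ℂ)
    (fun y => pullback (chartAt C3 x).symm η y) (chartAt C3 x).target

/-- The form `dz₁ ∧ dz₂ ∧ dz₃` on `ℂ³`, with value `det (v i j)` on the vectors `v 0, v 1, v 2`. -/
noncomputable def dz : Form C3 := fun _ =>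
  { toMultilinearMap := (Matrix.detRowAlternating (n := Fin 3) (R := ℂ)).toMultilinearMap
    map_eq_zero_of_eq' := (Matrix.detRowAlternating (n := Fin 3) (R := ℂ)).map_eq_zero_of_eq'
    cont := Continuous.matrix_det continuous_id }

/-- `Ω₀` is the form on `M₀ \ F` induced by `dz₁ ∧ dz₂ ∧ dz₃`: both have the same pullback to the part
of `ℂ³` over `M₀ \ F`. -/
def IsInduced (τ : Fin 3 → Period) (Ω₀ : Form (M0reg τ)) : Prop :=
  pullback (quotReg τ) Ω₀ = pullback (fun z : Ureg τ => (z : C3)) dz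

/-- `Ω` extends the pullback `π^* Ω₀`, a form on the complement of the exceptional divisor, to `M`. -/
def Extends (τ : Fin 3 → Period) (Ω : Form (M τ)) (Ω₀ : Form (M0reg τ)) : Prop :=
  pullback (fun x : Mreg τ => (x : M τ)) Ω = pullback (πreg τ) Ω₀

end BorceaVoisin

/-! A 3-form on a threefold is one function per chart, transforming by the Jacobian determinant.
Both manifolds here carry atlases of inverse local parametrizations, and in these the required forms
have constant coefficients: 1 on `M0reg τ` and on the part of `M τ` parametrized by `ℂ³`, and 1/2 in
the blow-up coordinates. So everything reduces to computing Jacobians of transition germs.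

Each nontrivial element of the group reverses exactly two of the three coordinates, so its linear
part has determinant 1 (`prod_lin`). Hence `dz₁ ∧ dz₂ ∧ dz₃` descends. More generally, two local
lifts to `ℂ³` of one map into the regular part of the quotient have equal Jacobians
(`det_fderiv_eq_of_orbit`). In the blow-up, `u = p^(1/2)` and `v = p^(1/2) q` give `du ∧ dv = (1/2)
dp ∧ dq`: the zero of one factor cancels the pole of the other (`det_fderiv_pt`).

Away from the exceptional divisor the parametrizations of `M τ` lift to `ℂ³`, so the chain rule
relates the Jacobian of a transition germ to the constants 1 and 1/2. The divisor has dense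
complement, so the relation persists on it by continuity and no transition has to be computed there
(`isDensity_M`). The resulting form is holomorphic because its chart coefficients are constant, and
vanishes nowhere because the constants are nonzero. Uniqueness is again continuity plus density
(`IsDensity.eq_form`).

The tangent space at `x` is identified with `ℂ³` by the preferred chart at `x`, which jumps with
`x`. Thus `Form.coeff` need not be continuous in `x`, and regularity is always tested in one fixed
chart. -/

namespace BorceaVoisin

/-! ### Alternating 3-forms on `ℂ³` -/

/-- The form `dz₁ ∧ dz₂ ∧ dz₃` as an alternating form on `ℂ³`. -/
noncomputable def vol : C3 [⋀^Fin 3]→L[ℂ] ℂ := dz 0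

theorem vol_apply (v : Fin 3 → C3) : vol v = Matrix.det (Matrix.of v) := rfl

theorem vol_basis : vol (fun i => Pi.single i 1) = 1 := by
  rw [vol_apply, ← Matrix.det_one (n := Fin 3) (R := ℂ)]
  congr 1
  ext i j
  simp [Matrix.one_apply, Pi.single_apply, eq_comm]

/-- The space of alternating 3-forms on `ℂ³` is a line: only injective families of basis vectors
matter, and those are permutations of the standard basis, which change both values by the same sign.
-/
theorem ext_basis {η η' : C3 [⋀^Fin 3]→L[ℂ] ℂ}
    (h : η (fun i => Pi.single i 1) = η' (fun i => Pi.single i 1)) : η = η' := by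
  refine ContinuousAlternatingMap.toAlternatingMap_injective ?_
  refine Module.Basis.ext_alternating (Pi.basisFun ℂ (Fin 3)) fun v hv => ?_
  obtain ⟨σ, rfl⟩ : ∃ σ : Equiv.Perm (Fin 3), ⇑σ = v :=
    ⟨Equiv.ofBijective v (Finite.injective_iff_bijective.1 hv), rfl⟩
  have h1 := η.toAlternatingMap.map_perm (fun i => (Pi.single i 1 : C3)) σ
  have h2 := η'.toAlternatingMap.map_perm (fun i => (Pi.single i 1 : C3)) σ
  simp only [Pi.basisFun_apply]
  refine h1.trans (Eq.trans ?_ h2.symm)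
  exact congrArg _ h

theorem eq_smul_vol (η : C3 [⋀^Fin 3]→L[ℂ] ℂ) : η = η (fun i => Pi.single i 1) • vol :=
  ext_basis (by rw [ContinuousAlternatingMap.smul_apply, vol_basis, smul_eq_mul, mul_one])

theorem det_eq_matrix_det (A : C3 →L[ℂ] C3) :
    A.det = Matrix.det (Matrix.of fun i j => A (Pi.single j 1) i) := by
  rw [ContinuousLinearMap.det, ← LinearMap.det_toMatrix']
  congr 1

theorem comp_apply_basis (η : C3 [⋀^Fin 3]→L[ℂ] ℂ) (A : C3 →L[ℂ] C3) :
    η (fun i => A (Pi.single i 1)) = A.det * η (fun i => Pi.single i 1) := by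
  conv_lhs => rw [eq_smul_vol η]
  -- The images of the basis vectors are the rows in `vol` but the columns in the matrix of `A`,
  -- hence the transpose.
  rw [ContinuousAlternatingMap.smul_apply, vol_apply, det_eq_matrix_det, ← Matrix.det_transpose,
    smul_eq_mul, mul_comm]
  rfl

theorem continuous_det : Continuous fun A : C3 →L[ℂ] C3 => A.det := by
  simp only [det_eq_matrix_det]
  refine Continuous.matrix_det ?_
  refine continuous_matrix fun i j => ?_
  simp only [Matrix.of_apply]
  fun_prop

/-! ### Pullbacks in charts -/

section
variable {X Y : Type} [TopologicalSpace X] [ChartedSpace C3 X] [TopologicalSpace Y]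
  [ChartedSpace C3 Y]

/-- Tangent spaces are copies of `ℂ³` through the preferred charts, so the manifold derivative is
the ordinary derivative of any germ `h` that expresses `f` in these charts. -/
theorem mfderiv_eq_fderiv {f : X → Y} {x : X} {h : C3 → C3} (hf : ContinuousAt f x)
    (hh : AnalyticAt ℂ h (chartAt C3 x x))
    (he : ∀ᶠ y in 𝓝 (chartAt C3 x x), chartAt C3 (f x) (f ((chartAt C3 x).symm y)) = h y) :
    (mfderiv 𝓘(ℂ, C3) 𝓘(ℂ, C3) f x : C3 →L[ℂ] C3) = fderiv ℂ h (chartAt C3 x x) := by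
  have he' : writtenInExtChartAt 𝓘(ℂ, C3) 𝓘(ℂ, C3) x f =ᶠ[𝓝 (chartAt C3 x x)] h := he
  have h1 : MDifferentiableAt 𝓘(ℂ, C3) 𝓘(ℂ, C3) f x :=
    (mdifferentiableAt_iff f x).2
      ⟨hf, (hh.differentiableAt.congr_of_eventuallyEq he').differentiableWithinAt⟩
  refine (if_pos h1).trans ?_
  simp only [modelWithCornersSelf_coe, Set.range_id, fderivWithin_univ]
  exact he'.fderiv_eq

/-- The coefficient of a 3-form with respect to `dz₁ ∧ dz₂ ∧ dz₃` in the preferred chart. -/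
noncomputable def Form.coeff (η : Form X) (x : X) : ℂ :=
  (η x : C3 [⋀^Fin 3]→L[ℂ] ℂ) fun i => Pi.single i 1

theorem Form.ext_coeff {η η' : Form X} (h : ∀ x, η.coeff x = η'.coeff x) : η = η' :=
  funext fun x => ext_basis (η := η x) (η' := η' x) (h x)

theorem Form.eq_coeff_smul (η : Form X) (x : X) :
    (show C3 [⋀^Fin 3]→L[ℂ] ℂ from η x) = η.coeff x • vol := eq_smul_vol _

/-- The form with coefficient function `c`. -/
noncomputable def Form.ofCoeff (c : X → ℂ) : Form X := fun x =>
  (c x • vol : C3 [⋀^Fin 3]→L[ℂ] ℂ)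

theorem Form.coeff_ofCoeff (c : X → ℂ) (x : X) : (Form.ofCoeff c).coeff x = c x := by
  change (c x • vol) (fun i => Pi.single i 1) = c x
  rw [ContinuousAlternatingMap.smul_apply, vol_basis, smul_eq_mul, mul_one]

/-- The change of variables formula; every later computation of a pullback consists in finding the
germ `h` and its Jacobian. -/
theorem Form.coeff_pullback {f : X → Y} {x : X} {h : C3 → C3} (hf : ContinuousAt f x)
    (hh : AnalyticAt ℂ h (chartAt C3 x x))
    (he : ∀ᶠ y in 𝓝 (chartAt C3 x x), chartAt C3 (f x) (f ((chartAt C3 x).symm y)) = h y)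
    (η : Form Y) :
    Form.coeff (pullback f η) x = (fderiv ℂ h (chartAt C3 x x)).det * η.coeff (f x) := by
  refine Eq.trans ?_ (comp_apply_basis (η (f x)) _)
  rw [← mfderiv_eq_fderiv hf hh he]
  rfl

theorem eventually_chart_symm_opens {U : TopologicalSpace.Opens X} (x : U) :
    ∀ᶠ y in 𝓝 (chartAt C3 x x), (((chartAt C3 x).symm y : U) : X) = (chartAt C3 (x : X)).symm y := by
  have : Nonempty U := ⟨x⟩
  filter_upwards [(chartAt C3 x).open_target.mem_nhds (mem_chart_target C3 x)] with y hy
  exact (OpenPartialHomeomorph.subtypeRestr_symm_apply (chartAt C3 (x : X)) ⟨x⟩ hy)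

/-- The preferred chart of an open subset is the restriction of that of the ambient space, so the
inclusion reads as the identity. -/
theorem Form.coeff_pullback_val (U : TopologicalSpace.Opens X) (η : Form X) (x : U) :
    Form.coeff (pullback (fun x : U => (x : X)) η) x = η.coeff x := by
  rw [Form.coeff_pullback (h := id) continuous_subtype_val.continuousAt analyticAt_id ?_]
  · simp [ContinuousLinearMap.det]
  · have h1 := (chartAt C3 (x : X)).open_target.mem_nhds (mem_chart_target C3 (x : X))
    filter_upwards [eventually_chart_symm_opens x, h1] with y h2 h3
    rw [h2, (chartAt C3 (x : X)).right_inv h3, id]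

end

/-! ### Forms with constant densities -/

namespace HolParam

variable {M : Type} [TopologicalSpace M] (P : HolParam M)

/-- The germ `h` at `v` commutes with the parametrizations `P.φ i` and `P.φ j`. -/
def IsTrans (i j : P.ι) (v : C3) (h : C3 → C3) : Prop :=
  ∀ᶠ v' in 𝓝 v, ∀ hv : v' ∈ P.V i, ∃ hw : h v' ∈ P.V j, P.φ j ⟨h v', hw⟩ = P.φ i ⟨v', hv⟩

/-- The forms with density `c i` in the parametrization `P.φ i` agree on overlaps. -/
def IsDensity (c : P.ι → ℂ) : Prop :=
  ∀ (i j : P.ι) (v : P.V i) (h : C3 → C3), AnalyticAt ℂ h v → P.IsTrans i j v h → c j * (fderiv ℂ h (v : C3)).det = c i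

/-- The form with density `c i` in the parametrization `P.φ i`. -/
noncomputable def form (c : P.ι → ℂ) : @Form M _ P.chartedSpace :=
  let _ := P.chartedSpace
  Form.ofCoeff fun x => c (P.idx x)

theorem chart_mem_dom (x : M) : P.chart x x ∈ P.dom x := by
  obtain ⟨w, hw⟩ := P.mem_par x
  have := P.chart_par x w
  rw [hw] at this
  rw [this]
  exact w.2

theorem par_chart (x : M) : P.par x ⟨P.chart x x, P.chart_mem_dom x⟩ = x := by
  obtain ⟨w, hw⟩ := P.mem_par x
  have := P.chart_par x w
  rw [hw] at this
  simp only [this]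
  exact hw

variable {P} in
-- The preferred chart at `x` inverts a parametrization, so reading `P.φ i` in it is a transition
-- germ, to which the density relation applies. This converts facts about parametrizations into
-- facts about charts.
theorem IsDensity.exists_germ {c : P.ι → ℂ} (hc : P.IsDensity c) {i : P.ι} (v : P.V i) {x : M}
    (hx : P.φ i v = x) : ∃ h : C3 → C3, AnalyticAt ℂ h v ∧ h v = P.chart x x ∧
      (∀ᶠ v' in 𝓝 (v : C3), ∀ hv : v' ∈ P.V i, P.chart x (P.φ i ⟨v', hv⟩) = h v') ∧
      c (P.idx x) * (fderiv ℂ h (v : C3)).det = c i := by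
  obtain ⟨h, h1, h2, h3⟩ := P.trans i (P.idx x) v ⟨P.chart x x, P.dom_sub x (P.chart_mem_dom x)⟩
    (hx.trans (P.par_chart x).symm)
  refine ⟨h, h1, h2, ?_, hc _ _ v h h1 h3⟩
  have h4 : ∀ᶠ v' in 𝓝 (v : C3), h v' ∈ P.dom x :=
    h1.continuousAt.eventually ((P.dom x).isOpen.mem_nhds (by rw [h2]; exact P.chart_mem_dom x))
  filter_upwards [h3, h4] with v' h5 h6 hv
  obtain ⟨_, h7⟩ := h5 hv
  rw [← h7]
  exact P.chart_par x ⟨h v', h6⟩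

/-- The form is defined at each point by the preferred chart of that point; the density relation
cancels the Jacobian of the passage to the one chart at `x`, leaving a constant. -/
theorem pullback_chart_symm (c : P.ι → ℂ) (hc : P.IsDensity c) (x : M) {y : C3}
    (hy : y ∈ P.dom x) :
    letI := P.chartedSpace
    Form.coeff (pullback (P.chart x).symm (P.form c)) y = c (P.idx x) := by
  let _ := P.chartedSpace
  obtain ⟨h, h1, h2, h3, h4⟩ := hc.exists_germ ⟨y, P.dom_sub x hy⟩ (x := (P.chart x).symm y)
    (P.chart_symm x ⟨y, hy⟩).symm
  have hy' : y ∈ (P.chart x).target := by rwa [P.chart_target]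
  rw [Form.coeff_pullback (h := h) ((P.chart x).symm.continuousAt hy') h1, form,
    Form.coeff_ofCoeff, ← h4, mul_comm]
  · rfl
  · filter_upwards [h3, (P.dom x).isOpen.mem_nhds hy] with y' h5 h6
    rw [← h5 (P.dom_sub x h6)]
    exact congrArg (P.chart _) (P.chart_symm x ⟨y', h6⟩)

variable {P} in
theorem IsDensity.isHolomorphic {c : P.ι → ℂ} (hc : P.IsDensity c) :
    @IsHolomorphic M _ P.chartedSpace (P.form c) := by
  let _ := P.chartedSpace
  intro x
  refine DifferentiableOn.congr (f := fun _ => c (P.idx x) • vol)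
    (differentiableOn_const _) fun y hy => ?_
  rw [← P.pullback_chart_symm c hc x (y := y) (by rwa [← SetLike.mem_coe, ← P.chart_target])]
  exact Form.eq_coeff_smul _ _

variable {P} in
/-- A holomorphic form is determined by its values at a set of points that is dense in each chart. -/
theorem IsDensity.eq_form {c : P.ι → ℂ} (hc : P.IsDensity c) (h0 : ∀ i, c i ≠ 0) {S : Set M}
    (hS : ∀ x, ∃ᶠ y in 𝓝 (P.chart x x), (P.chart x).symm y ∈ S)
    {η : @Form M _ P.chartedSpace} (hη : @IsHolomorphic M _ P.chartedSpace η)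
    (h : ∀ x ∈ S, η x = P.form c x) : η = P.form c := by
  let _ := P.chartedSpace
  refine Form.ext_coeff fun x => ?_
  have hx := P.chart_mem_dom x
  have hx' : P.chart x x ∈ (P.chart x).target := by rwa [P.chart_target]
  have h1 : ContinuousAt (fun y => Form.coeff (pullback (P.chart x).symm η) y) (P.chart x x) := by
    have h2 : ContinuousAt (Y := C3 [⋀^Fin 3]→L[ℂ] ℂ) (fun y => pullback (P.chart x).symm η y)
      (P.chart x x) :=
      (hη x).continuousOn.continuousAt ((P.chart x).open_target.mem_nhds hx')
    exact (ContinuousEvalConst.continuous_eval_const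
      (F := C3 [⋀^Fin 3]→L[ℂ] ℂ) _).continuousAt.comp h2
  have h2 : Form.coeff (pullback (P.chart x).symm η) (P.chart x x) = c (P.idx x) := by
    -- By continuity a wrong value would persist on a neighbourhood, which contains points mapped
    -- into `S`.
    by_contra h3
    refine ((hS x).and_eventually ((h1.eventually_ne h3).and
      ((P.dom x).isOpen.mem_nhds hx))).exists.elim fun y hy => hy.2.1 ?_
    rw [← P.pullback_chart_symm c hc x hy.2.2]
    simp only [Form.coeff, pullback, h _ hy.1]
  have h3 := P.pullback_chart_symm c hc x hx
  -- The point `(P.chart x).symm (P.chart x x)` equals `x` only propositionally. Both forms are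
  -- therefore transported by the same germ `k`, whose Jacobian is cancelled; it is nonzero as a
  -- factor of `c (P.idx x)`.
  obtain ⟨k, h4, -, h5, -⟩ := hc.exists_germ ⟨_, P.dom_sub x hx⟩ (x := (P.chart x).symm _)
    (P.chart_symm x ⟨_, hx⟩).symm
  have h6 : ∀ᶠ y in 𝓝 (P.chart x x),
      P.chart ((P.chart x).symm (P.chart x x)) ((P.chart x).symm y) = k y := by
    filter_upwards [h5, (P.dom x).isOpen.mem_nhds hx] with y h6 h7
    rw [← h6 (P.dom_sub x h7)]
    exact congrArg (P.chart _) (P.chart_symm x ⟨y, h7⟩)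
  rw [Form.coeff_pullback (h := k) ((P.chart x).symm.continuousAt hx') h4 h6] at h2 h3
  have h7 := mul_left_cancel₀ (left_ne_zero_of_mul (h3.trans_ne (h0 _))) (h2.trans h3.symm)
  rwa [(P.chart x).left_inv (mem_chart_source C3 x)] at h7

end HolParam

variable {τ : Fin 3 → Period}

/-! ### The coefficients of the forms in the parametrizations -/

/-- This is the invariance of `dz₁ ∧ dz₂ ∧ dz₃` under the group: `α`, `β` and their product each
reverse two coordinates. -/
theorem prod_lin (g : Bool × Bool) : ∏ i, lin g i = 1 := by
  obtain ⟨_ | _, _ | _⟩ := g <;> simp [lin, Fin.prod_univ_three]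

theorem det_diagonal (d : C3) : (ContinuousLinearMap.mul ℂ C3 d).det = ∏ i, d i := by
  rw [det_eq_matrix_det, ← Matrix.det_diagonal]
  congr 1
  ext i j
  by_cases h : i = j
  · subst h; simp
  · simp [h]

/-- The group element may a priori depend on `x`. Proper discontinuity near a point with free orbit
forces `k'` to be, near `v`, the composite of `k` with one fixed affine map of linear part `lin g`,
which has determinant 1. -/
theorem det_fderiv_eq_of_orbit {k k' : C3 → C3} {v : C3} (hk : AnalyticAt ℂ k v)
    (hk' : AnalyticAt ℂ k' v) (hv : proj τ (k v) ∈ Free τ)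
    (h : ∀ᶠ x in 𝓝 v, ∃ g, proj τ (k' x) = act τ g (proj τ (k x))) :
    (fderiv ℂ k' v).det = (fderiv ℂ k v).det := by
  obtain ⟨g, hg⟩ := h.self_of_nhds
  have hv' : k' v ∈ dom τ none := by
    change proj τ _ ∈ Free τ
    rwa [hg, act_mem_Free]
  -- The lift `k` moved by the covering transformation over `g` that carries `k v` to `k' v`.
  let m : C3 → C3 := fun x => k' v + lin g * (k x - k v)
  have h1 : Filter.Tendsto (fun x => (m x, k' x)) (𝓝 v) (𝓝 (k' v, k' v)) := by
    have h2 : ContinuousAt (fun x => (m x, k' x)) v :=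
      (continuousAt_const.add (continuousAt_const.mul (hk.continuousAt.sub continuousAt_const))).prodMk
        hk'.continuousAt
    simpa [ContinuousAt, m] using h2
  have h2 : k' =ᶠ[𝓝 v] m := by
    filter_upwards [h1.eventually (inj_none hv'), h] with x h3 ⟨g', h4⟩
    -- The points `m x` and `k' x` lie over one orbit, the connecting element being `g' g`, and are
    -- both close to `k' v`, so they coincide.
    refine (h3 ⟨(xor g'.1 g.1, xor g'.2 g.2), 1, one_ne_zero, ?_, by simp [raw]⟩).symm
    simp only [raw, m]
    rw [deck_germ hg, h4, ← act_act, act_self]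
  have h3 : HasFDerivAt m ((ContinuousLinearMap.mul ℂ C3 (lin g)).comp (fderiv ℂ k v)) v :=
    ((ContinuousLinearMap.mul ℂ C3 (lin g)).hasFDerivAt.comp v
      (hk.differentiableAt.hasFDerivAt.sub_const (k v))).const_add (k' v)
  rw [h2.fderiv_eq, h3.fderiv]
  have h4 := det_diagonal (lin g)
  rw [prod_lin] at h4
  change LinearMap.det ((ContinuousLinearMap.mul ℂ C3 (lin g)).toLinearMap ∘ₗ
    (fderiv ℂ k v).toLinearMap) = _
  rw [LinearMap.det_comp]
  change ContinuousLinearMap.det _ * ContinuousLinearMap.det _ = _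
  rw [h4, one_mul]

/-- A transition germ and the identity are two lifts of the same map to the quotient. -/
theorem isDensity_M0reg (τ : Fin 3 → Period) : (paramM0reg τ).IsDensity fun _ => 1 := by
  intro _ _ v h h1 h2
  have h3 := det_fderiv_eq_of_orbit (τ := τ) (k := id) (k' := h) analyticAt_id h1
    (toM0_mem_F.1 v.2) (by
      filter_upwards [h2, (Ureg τ).isOpen.mem_nhds v.2] with x h3 h4
      obtain ⟨h5, h6⟩ := h3 h4
      exact toM0_eq.1 (congrArg Subtype.val h6).symm)
  rw [h3]
  simp [ContinuousLinearMap.det]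

/-- The coefficient of the form on `M` in the coordinates of the blow-up: if `u = p ^ (1/2)` and
`v = p ^ (1/2) * q`, then `du ∧ dv = (1/2) dp ∧ dq`. -/
noncomputable def density : Option (LineIndex τ) → ℂ
  | none => 1
  | some _ => 1 / 2

theorem density_ne_zero (o : Option (LineIndex τ)) : density o ≠ 0 := by
  rcases o with _ | L <;> simp [density]

/-- Up to reordering the indices the Jacobian matrix is triangular with diagonal `(2ρ)⁻¹`, `ρ`, `1`.
The parameters `p`, `q`, `s` keep the indices of the coordinates they replace, so no sign depends on
which normal coordinate is `u`. -/
theorem det_fderiv_pt (L : LineIndex τ) {ρ : C3 → ℂ} {w₀ : C3} (hρ : AnalyticAt ℂ ρ w₀)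
    (h : ∀ w, ρ w ^ 2 = w L.i) (h0 : w₀ L.i ≠ 0) :
    (fderiv ℂ (fun w => L.pt (ρ w) w) w₀).det = 1 / 2 := by
  have hp : ∀ l, HasFDerivAt (fun w : C3 => w l)
      (ContinuousLinearMap.proj (R := ℂ) (φ := fun _ : Fin 3 => ℂ) l) w₀ := fun l =>
    (ContinuousLinearMap.proj (R := ℂ) (φ := fun _ : Fin 3 => ℂ) l).hasFDerivAt
  have hr : ρ w₀ ≠ 0 := fun h1 => h0 (by rw [← h w₀, h1]; simp)
  have h1 := hρ.differentiableAt.hasFDerivAt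
  -- Differentiating `ρ ^ 2 = w L.i` gives `2 ρ dρ = dw_i`.
  have h2 : ∀ m, fderiv ℂ ρ w₀ (Pi.single m 1) = if m = L.i then (2 * ρ w₀)⁻¹ else 0 := by
    intro m
    have h3 := (h1.pow 2).unique ((hp L.i).congr_of_eventuallyEq (.of_forall h))
    have h4 := DFunLike.congr_fun h3 (Pi.single m 1)
    simp [Pi.single_apply, eq_comm (a := L.i)] at h4
    split_ifs at h4 ⊢ with h6
    · field_simp
      linear_combination h4
    · simp_all
  have h5 : ∀ l, HasFDerivAt (fun w => L.pt (ρ w) w l) (if l = L.i then fderiv ℂ ρ w₀ else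
      if l = tang L.b then ContinuousLinearMap.proj (R := ℂ) (φ := fun _ : Fin 3 => ℂ) l else
      ρ w₀ • ContinuousLinearMap.proj (R := ℂ) (φ := fun _ : Fin 3 => ℂ) l + w₀ l • fderiv ℂ ρ w₀)
      w₀ := by
    intro l
    simp only [LineIndex.pt]
    split_ifs
    exacts [h1.const_add _, (hp l).const_add _, (h1.mul (hp l)).const_add _]
  rw [(hasFDerivAt_pi.2 h5).fderiv, det_eq_matrix_det]
  have hi := L.hi
  -- Here `j` plays the role of `tang L.b`; all six pairs of distinct indices are checked.
  have h6 : ∀ i j : Fin 3, i ≠ j → Matrix.det (Matrix.of fun l m : Fin 3 => 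
      if l = i then (if m = i then (2 * ρ w₀)⁻¹ else 0) else if l = j then (if l = m then 1 else 0)
      else ρ w₀ * (if l = m then 1 else 0) + w₀ l * (if m = i then (2 * ρ w₀)⁻¹ else 0)) = 1 / 2 := by
    intro i j hij
    rw [Matrix.det_fin_three]
    fin_cases i <;> fin_cases j <;> simp at hij <;> simp <;> field_simp
  rw [← h6 _ _ hi]
  congr 1
  ext l m
  simp only [Matrix.of_apply, ContinuousLinearMap.coe_pi', ← h2]
  split_ifs <;> simp_all

/-! ### Lifts away from the exceptional divisor and the density on `M` -/

theorem isOpen_off_param (o : Option (LineIndex τ)) : IsOpen {v : C3 | Off o v} := by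
  rcases o with _ | L
  · simp [Off]
  · simp only [Off, Option.mem_some_iff, forall_eq']
    exact isOpen_ne_fun (continuous_apply L.i) continuous_const

theorem frequently_off (o : Option (LineIndex τ)) (v : C3) : ∃ᶠ x in 𝓝 v, Off o x := by
  rcases o with _ | L
  · exact (Filter.Eventually.of_forall fun x => by simp [Off]).frequently
  · simp only [Off, Option.mem_some_iff, forall_eq']
    have h1 : ∃ᶠ t in 𝓝 (v L.i), t ≠ 0 := by
      have := mem_closure_iff_frequently.1 (dense_compl_singleton (0 : ℂ) (v L.i))
      exact this
    have h2 : Filter.Tendsto (fun t => Function.update v L.i t) (𝓝 (v L.i)) (𝓝 v) := by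
      -- Varying the coordinate `L.i` alone already leaves the divisor.
      have : ContinuousAt (fun t => Function.update v L.i t) (v L.i) := by fun_prop
      simpa [ContinuousAt] using this
    exact h2.frequently (h1.mono fun t ht => by simpa using ht)

/-- A lift of a parametrization of `M` to `ℂ³` near a parameter outside the exceptional divisor. -/
theorem exists_lift {o : Option (LineIndex τ)} {v : C3} (hv : v ∈ dom τ o) (h : Off o v) :
    ∃ k : C3 → C3, AnalyticAt ℂ k v ∧ (fderiv ℂ k v).det = density o ∧
      ∀ᶠ x in 𝓝 v, k x ∈ dom τ none ∧ ∃ g, proj τ (k x) = act τ g (raw τ o x).1 := by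
  have hdom := (isOpen_dom o).mem_nhds hv
  rcases o with _ | L
  · refine ⟨id, analyticAt_id, by simp [density, ContinuousLinearMap.det], ?_⟩
    filter_upwards [hdom] with x hx
    exact ⟨hx, (false, false), rfl⟩
  · have h0 := h L rfl
    have h1 : ((v L.i) ^ ((2 : ℂ)⁻¹)) ^ 2 = v L.i := Complex.cpow_ofNat_inv_pow _ 2
    -- The principal root in `LineIndex.lift` is not holomorphic across its cut. A local branch
    -- differs from it by a sign at most, and the involution of the fixed curve absorbs the sign.
    obtain ⟨ρ, h2, h3, h4⟩ := exists_branch L h1 h0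
    refine ⟨fun w => L.pt (ρ w) w, analyticAt_pt L h2, det_fderiv_pt L h2 h4 h0, ?_⟩
    filter_upwards [hdom, (isOpen_off_param (some L)).mem_nhds h] with x hx h5
    exact ⟨(mem_dom_some (h4 x) (h5 L rfl)).1 hx, L.proj_lift (h4 x)⟩

/-- With `k` and `k'` lifts of the two parametrizations, `k' ∘ h` and `k` lift the same map to the
quotient, so their Jacobians agree; the chain rule does the rest. -/
theorem density_mul_det {o o' : Option (LineIndex τ)} {v : C3} {h : C3 → C3} (hv : v ∈ dom τ o)
    (h0 : Off o v) (h1 : AnalyticAt ℂ h v) (h2 : (paramM τ).IsTrans o o' v h) :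
    density o' * (fderiv ℂ h v).det = density o := by
  obtain ⟨hv', hr⟩ := h2.self_of_nhds hv
  obtain ⟨k, k1, k2, k3⟩ := exists_lift hv h0
  obtain ⟨k', k1', k2', k3'⟩ := exists_lift hv' ((par_eq.1 hr).symm.off h0)
  rw [← k2, ← k2']
  rw [← det_fderiv_eq_of_orbit (τ := τ) (k' := k' ∘ h) k1 (k1'.comp h1) k3.self_of_nhds.1]
  · rw [fderiv_comp v k1'.differentiableAt h1.differentiableAt]
    exact (LinearMap.det_comp _ _).symm
  · filter_upwards [k3, h1.continuousAt.eventually k3', h2, (isOpen_dom o).mem_nhds hv]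
      with x ⟨_, g, e1⟩ ⟨_, g', e2⟩ e3 e4
    obtain ⟨e5, e6⟩ := e3 e4
    obtain ⟨g'', -, -, e7, -⟩ := par_eq.1 e6
    exact toM0_eq.1 ((toM0_eq.2 ⟨g, e1⟩).symm.trans ((toM0_eq.2 ⟨g'', e7⟩).symm.trans
      (toM0_eq.2 ⟨g', e2⟩)))

/-- At an exceptional point the relation is a limit of the relation at nearby non-exceptional
parameters, where `h` is still an analytic transition germ. -/
theorem isDensity_M (τ : Fin 3 → Period) : (paramM τ).IsDensity density := by
  intro o o' v h h1 h2
  by_contra h3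
  have h4 : ContinuousAt (fun x => density o' * (fderiv ℂ h x).det) v :=
    continuousAt_const.mul (continuous_det.continuousAt.comp h1.fderiv.continuousAt)
  have h5 := (h4.eventually_ne h3).and (h1.eventually_analyticAt.and
    ((eventually_eventually_nhds.2 h2).and ((isOpen_dom o).mem_nhds v.2)))
  obtain ⟨x, h6, h7, h8, h9, h10⟩ := ((frequently_off o v).and_eventually h5).exists
  exact h7 (density_mul_det h10 h6 h8 h9)

/-! ### The quotient map and the blow-down map in the parametrizations -/

theorem eventually_chart_symm_mem {U : TopologicalSpace.Opens C3} (z : U) :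
    ∀ᶠ y in 𝓝 (z : C3), (((chartAt C3 z).symm y : U) : C3) = y :=
  eventually_chart_symm_opens z

/-- The covering map is itself the parametrization of `M0reg τ`, so its Jacobian in the preferred
charts is 1. -/
theorem coeff_pullback_quotReg (η : Form (M0reg τ)) (z : Ureg τ) :
    Form.coeff (pullback (quotReg τ) η) z = η.coeff (quotReg τ z) := by
  obtain ⟨h, h1, -, h3, h4⟩ := (isDensity_M0reg τ).exists_germ (i := ()) z rfl
  rw [one_mul] at h4
  have hq : Continuous (quotReg τ) := (paramM0reg τ).cont ()
  rw [Form.coeff_pullback (h := h) hq.continuousAt (x := z) h1]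
  · exact (congrArg (· * _) h4).trans (one_mul _)
  · filter_upwards [h3, eventually_chart_symm_mem z, (Ureg τ).isOpen.mem_nhds z.2] with y h5 h6 h7
    rw [← h5 h7]
    have h8 : (chartAt C3 z).symm y = (⟨y, h7⟩ : Ureg τ) := Subtype.ext h6
    rw [h8]
    rfl

theorem coeff_dz (z : C3) : Form.coeff dz z = 1 := vol_basis

theorem quotReg_surjective (τ : Fin 3 → Period) : Function.Surjective (quotReg τ) := fun x => by
  obtain ⟨_, z, h⟩ := (paramM0reg τ).cover x
  exact ⟨z, h⟩

/-- Since `quotReg τ` is surjective with Jacobian 1, being induced prescribes every coefficient.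
This yields existence and uniqueness of `Ω₀` together. -/
theorem isInduced_iff {η : Form (M0reg τ)} : IsInduced τ η ↔ ∀ x, η.coeff x = 1 := by
  rw [(quotReg_surjective τ).forall]
  have h1 : ∀ z : Ureg τ, Form.coeff (pullback (fun z : Ureg τ => (z : C3)) dz) z = 1 := fun z =>
    (Form.coeff_pullback_val _ _ z).trans (coeff_dz _)
  constructor
  · intro h z
    rw [← coeff_pullback_quotReg, h, h1]
  · exact fun h => Form.ext_coeff fun z => by rw [coeff_pullback_quotReg, h, h1]

theorem π_par (o : Option (LineIndex τ)) (v : dom τ o) : π τ (par o v) = toM0 τ (raw τ o v).1 := rfl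

theorem π_par_mem_F {o : Option (LineIndex τ)} {v : dom τ o} : π τ (par o v) ∉ F τ ↔ Off o v := by
  rw [π_par, toM0_mem_F, off_iff]
  have hp := isPt_raw o v.2
  exact ⟨hp.1, fun h b hb => (hp.2 b hb).1 h⟩

/-- The blow-down map, read in a preferred chart of `M τ`, factors locally through `ℂ³`. -/
theorem exists_lift_chart (x : Mreg τ) : ∃ k : C3 → C3, AnalyticAt ℂ k ((paramM τ).chart x x) ∧
    (fderiv ℂ k ((paramM τ).chart x x)).det = density ((paramM τ).idx x) ∧
      ∀ᶠ y in 𝓝 ((paramM τ).chart x x), k y ∈ Ureg τ ∧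
        π τ (((paramM τ).chart x).symm y) = toM0 τ (proj τ (k y)) := by
  have hx := (paramM τ).chart_mem_dom x
  have hp : par (τ := τ) _ ⟨_, (paramM τ).dom_sub x hx⟩ = x := (paramM τ).par_chart x
  obtain ⟨k, h1, h2, h3⟩ := exists_lift ((paramM τ).dom_sub x hx)
    (π_par_mem_F.1 (hp.symm ▸ x.2))
  refine ⟨k, h1, h2, ?_⟩
  filter_upwards [h3, ((paramM τ).dom x).isOpen.mem_nhds hx] with y ⟨h4, g, h5⟩ h6
  refine ⟨toM0_mem_F.2 h4, ?_⟩
  rw [(paramM τ).chart_symm x ⟨y, h6⟩]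
  exact (π_par _ ⟨y, (paramM τ).dom_sub x h6⟩).trans (toM0_eq.2 ⟨g, h5⟩)

/-- In charts `πreg τ` is `h ∘ k`, where `k` lifts it to `ℂ³` with Jacobian `density` and `h`
expresses the covering map, with Jacobian 1. -/
theorem coeff_pullback_πreg (η : Form (M0reg τ)) (x : Mreg τ) :
    Form.coeff (pullback (πreg τ) η) x = density ((paramM τ).idx x) * η.coeff (πreg τ x) := by
  obtain ⟨k, k1, k2, k3⟩ := exists_lift_chart x
  have hx : ((paramM τ).chart (x : M τ)).symm ((paramM τ).chart x x) = x :=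
    ((paramM τ).chart (x : M τ)).left_inv (mem_chart_source C3 (x : M τ))
  have hc : ContinuousAt ((paramM τ).chart x) (x : M τ) :=
    ((paramM τ).chart (x : M τ)).continuousAt (mem_chart_source C3 (x : M τ))
  obtain ⟨h, h1, -, h3, h4⟩ := (isDensity_M0reg τ).exists_germ (i := ())
    ⟨k ((paramM τ).chart x x), k3.self_of_nhds.1⟩ (x := πreg τ x)
    (Subtype.ext (k3.self_of_nhds.2.symm.trans (by rw [hx]; rfl)))
  rw [one_mul] at h4
  change AnalyticAt ℂ h (k ((paramM τ).chart x x)) at h1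
  -- Continuity is read off the lift: near `x` the map `π τ` is the composite of the chart, `k` and
  -- the quotient map from `ℂ³`.
  have hπ : ContinuousAt (π τ) (x : M τ) := by
    have h5 : ContinuousAt (fun m => toM0 τ (proj τ (k ((paramM τ).chart x m)))) (x : M τ) :=
      ((continuous_toM0 τ).comp (continuous_proj τ)).continuousAt.comp
        (ContinuousAt.comp (f := (paramM τ).chart x) k1.continuousAt hc)
    refine h5.congr ?_
    filter_upwards [hc.eventually k3, ((paramM τ).chart (x : M τ)).open_source.mem_nhds
      (mem_chart_source C3 (x : M τ))] with m h6 h7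
    rw [← h6.2, ((paramM τ).chart (x : M τ)).left_inv h7]
  have hπ' : ContinuousAt (πreg τ) x :=
    Topology.IsInducing.subtypeVal.continuousAt_iff.2 (hπ.comp continuous_subtype_val.continuousAt)
  rw [Form.coeff_pullback (h := h ∘ k) hπ' (AnalyticAt.comp (f := k) h1 k1)]
  · congr 1
    rw [← k2]
    change (fderiv ℂ (h ∘ k) ((paramM τ).chart x x)).det = _
    rw [fderiv_comp _ h1.differentiableAt k1.differentiableAt]
    refine (LinearMap.det_comp _ _).trans ?_
    exact (congrArg (· * _) h4).trans (one_mul _)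
  · filter_upwards [k1.continuousAt.eventually h3, k3, eventually_chart_symm_opens x]
      with y h5 h6 h7
    rw [Function.comp_apply, ← h5 h6.1]
    refine congrArg ((paramM0reg τ).chart _) (Subtype.ext ?_)
    exact (congrArg (π τ) h7).trans h6.2

theorem frequently_mem_Mreg (x : M τ) :
    ∃ᶠ y in 𝓝 ((paramM τ).chart x x), ((paramM τ).chart x).symm y ∈ Mreg τ := by
  refine ((frequently_off ((paramM τ).idx x) _).and_eventually
    (((paramM τ).dom x).isOpen.mem_nhds ((paramM τ).chart_mem_dom x))).mono fun y hy => ?_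
  rw [(paramM τ).chart_symm x ⟨y, hy.2⟩]
  exact π_par_mem_F.2 hy.1

end BorceaVoisin

/-! ### Existence, nonvanishing and uniqueness of the holomorphic volume form -/

theorem lemma1 (τ : Fin 3 → BorceaVoisin.Period) :
    ∃ Ω₀ : BorceaVoisin.Form (BorceaVoisin.M0reg τ),
      BorceaVoisin.IsHolomorphic Ω₀ ∧ BorceaVoisin.IsInduced τ Ω₀ ∧
      (∀ η : BorceaVoisin.Form (BorceaVoisin.M0reg τ), BorceaVoisin.IsInduced τ η → η = Ω₀) ∧
      ∃ Ω : BorceaVoisin.Form (BorceaVoisin.M τ),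
        BorceaVoisin.IsHolomorphic Ω ∧ BorceaVoisin.Extends τ Ω Ω₀ ∧
        (∀ x : BorceaVoisin.M τ, Ω x ≠ 0) ∧
        ∀ η : BorceaVoisin.Form (BorceaVoisin.M τ),
          BorceaVoisin.IsHolomorphic η → BorceaVoisin.Extends τ η Ω₀ → η = Ω := by
  open BorceaVoisin in
  have h₀ : ∀ x, Form.coeff ((paramM0reg τ).form fun _ => 1) x = 1 := Form.coeff_ofCoeff _
  have h₁ : ∀ x, Form.coeff ((paramM τ).form density) x = density ((paramM τ).idx x) :=
    Form.coeff_ofCoeff _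
  refine ⟨(paramM0reg τ).form fun _ => 1, (isDensity_M0reg τ).isHolomorphic, isInduced_iff.2 h₀,
    fun η hη => Form.ext_coeff fun x => by rw [isInduced_iff.1 hη, h₀],
    (paramM τ).form density, (isDensity_M τ).isHolomorphic, ?_, fun x h => ?_, fun η hη he => ?_⟩
  · refine Form.ext_coeff fun x => ?_
    rw [coeff_pullback_πreg, Form.coeff_pullback_val, h₁, h₀, mul_one]
  · refine density_ne_zero ((paramM τ).idx x) ((h₁ x).symm.trans ?_)
    rw [Form.coeff, h]
    rfl
  -- Extending `π^* Ω₀` fixes the coefficients off the exceptional divisor, and holomorphy carries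
  -- this across it.
  · refine (isDensity_M τ).eq_form density_ne_zero (S := Mreg τ) frequently_mem_Mreg hη fun x hx => ?_
    refine ext_basis ?_
    change Form.coeff η x = Form.coeff ((paramM τ).form density) x
    rw [h₁, ← Form.coeff_pullback_val (Mreg τ) η ⟨x, hx⟩, he, coeff_pullback_πreg, h₀, mul_one]
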